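/- Let $\mathbb K=\mathbb R$ or $\mathbb C$ and let $G$ be a connected (finite-dimensional, smooth if $\mathbb K=\mathbb R$, complex if $\mathbb K=\mathbb C$) Lie group with Lie algebra $\mathfrak g=T_eG$. For $u\in\mathfrak g$ let $u^+$ be the left-invariant vector field on $G$ with $u^+(e)=u$. Linear connections on $G$ are smooth (holomorphic if $\mathbb K=\mathbb C$) connections on $TG$, with torsion $T(X,Y)=\nabla_XY-\nabla_YX-[X,Y]$ and curvature $K(X,Y)=[\nabla_X,\nabla_Y]-\nabla_{[X,Y]}$; a connection is left invariant if it is preserved by all left translations, and bi-invariant if it is preserved by all left and all right translations. Let $\nabla^0$ be the connection with $\nabla^0_{u^+}v^+=\frac12[u^+,v^+]$ for all $u,v\in\mathfrak g$. A Poisson structure on $\mathfrak g$ is a bilinear product $\circ$ on $\mathfrak g$ that is commutative, associative and satisfies $[u,v\circ w]=[u,v]\circ w+v\circ[u,w]$ for all $u,v,w$; then $(\mathfrak g,[\;,\;],\circ)$ is called a Poisson algebra. Then: 1. Let $\nabla$ be a left-invariant linear connection on $G$ and put $u\circ v=(\nabla_{u^+}v^+)(e)-\frac12[u,v]$ for $u,v\in\mathfrak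 g$. Then $(\mathfrak g,[\;,\;],\circ)$ is a Poisson algebra if and only if $\nabla$ is torsion free, bi-invariant and has the same curvature as $\nabla^0$. 2. Let $\circ$ be a product on $\mathfrak g$ such that $(\mathfrak g,[\;,\;],\circ)$ is a Poisson algebra. Then there is a unique linear connection $\nabla$ on $G$ with $\nabla_{u^+}v^+=\frac12[u^+,v^+]+(u\circ v)^+$ for all $u,v\in\mathfrak g$, and it is torsion free, bi-invariant and has the same curvature as $\nabla^0$. Consequently, calling a linear connection on $G$ special if it is torsion free, bi-invariant and has the same curvature as $\nabla^0$, the map that sends $\nabla$ to the product $\circ$ of part 1 is a bijection from the set of special connections on $G$ onto the set of Poisson structures on $\mathfrak g$, and its inverse sends $\circ$ to the connection of part 2. -/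

import Mathlib

open Bundle VectorField
open scoped Manifold ContDiff

noncomputable section

/-- Over `ℝ` or `ℂ`, a smooth Lie group is regular enough for Mathlib's Lie algebra structure on
its tangent space at the identity. -/
instance minSmoothnessThreeLEInfty {𝕜 : Type*} [RCLike 𝕜] :
    ENat.LEInfty (minSmoothness 𝕜 3) :=
  ⟨by rw [minSmoothness_of_isRCLikeNormedField]; exact ENat.LEInfty.out⟩

/-- A bilinear product `∘` on a Lie algebra makes it a Poisson algebra if it is commutative,
associative and satisfies `[u, v ∘ w] = [u, v] ∘ w + v ∘ [u, w]`. -/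
structure IsPoissonProduct {K L : Type*} [CommRing K] [LieRing L] [LieAlgebra K L]
    (mul : L →ₗ[K] L →ₗ[K] L) : Prop where
  comm : ∀ u v : L, mul u v = mul v u
  assoc : ∀ u v w : L, mul (mul u v) w = mul u (mul v w)
  leibniz : ∀ u v w : L, ⁅u, mul v w⁆ = mul ⁅u, v⁆ w + mul v ⁅u, w⁆

namespace LieConnection

section General

variable {𝕜 : Type*} [RCLike 𝕜] {E : Type*} [NormedAddCommGroup E] [NormedSpace 𝕜 E]
  {H : Type*} [TopologicalSpace H] {I : ModelWithCorners 𝕜 E H}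
  {G : Type*} [TopologicalSpace G] [ChartedSpace H G] [Group G] [LieGroup I ∞ G]

/-- Smooth vector fields. -/
def IsSmoothField (X : (g : G) → TangentSpace I g) : Prop :=
  ContMDiff I I.tangent ∞ (fun g => (TotalSpace.mk' E g (X g) : TangentBundle I G))

/-- The vector field `∇_X Y`. -/
def covField (nabla : CovariantDerivative I E (TangentSpace I : G → Type _))
    (X Y : (g : G) → TangentSpace I g) : (g : G) → TangentSpace I g :=
  fun g => nabla Y g (X g)

/-- `K(X, Y) Z = ∇_X ∇_Y Z - ∇_Y ∇_X Z - ∇_{[X, Y]} Z`. -/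
def curvatureField (nabla : CovariantDerivative I E (TangentSpace I : G → Type _))
    (X Y Z : (g : G) → TangentSpace I g) : (g : G) → TangentSpace I g :=
  covField nabla X (covField nabla Y Z) - covField nabla Y (covField nabla X Z) -
    covField nabla (mlieBracket I X Y) Z

/-- Two connections have the same curvature tensor. -/
def SameCurvature
    (nabla nabla' : CovariantDerivative I E (TangentSpace I : G → Type _)) : Prop :=
  ∀ X Y Z : (g : G) → TangentSpace I g, IsSmoothField X → IsSmoothField Y → IsSmoothField Z →
    curvatureField nabla X Y Z = curvatureField nabla' X Y Z

/-- The connection is preserved by `φ`: `φ^* (∇_X Y) = ∇_{φ^* X} (φ^* Y)` for all smooth vector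
fields (used only for diffeomorphisms `φ`). -/
def IsPreservedBy
    (nabla : CovariantDerivative I E (TangentSpace I : G → Type _)) (φ : G → G) : Prop :=
  ∀ X Y : (g : G) → TangentSpace I g, IsSmoothField X → IsSmoothField Y →
    mpullback I I φ (covField nabla X Y) =
      covField nabla (mpullback I I φ X) (mpullback I I φ Y)

/-- Invariance under all left translations. -/
def IsLeftInvariant
    (nabla : CovariantDerivative I E (TangentSpace I : G → Type _)) : Prop :=
  ∀ a : G, IsPreservedBy nabla (fun g => a * g)

/-- Invariance under all left and all right translations. -/
def IsBiInvariant
    (nabla : CovariantDerivative I E (TangentSpace I : G → Type _)) : Prop :=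
  IsLeftInvariant nabla ∧ ∀ a : G, IsPreservedBy nabla (fun g => g * a)

/-- A Mathlib covariant derivative also has (meaningless) values at vector fields that are not
differentiable; two of them are the same connection when they agree at all smooth vector fields. -/
def SameConnection
    (nabla nabla' : CovariantDerivative I E (TangentSpace I : G → Type _)) : Prop :=
  ∀ Y : (g : G) → TangentSpace I g, IsSmoothField Y → nabla Y = nabla' Y

/-- The differential at `1` of the left translation by `g`, so that `leftTo g v = v⁺(g)`. -/
def leftTo (g : G) : GroupLieAlgebra I G →L[𝕜] TangentSpace I g :=
  mfderiv I I (fun h => g * h) (1 : G)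

/-- The differential at `g` of the left translation by `g⁻¹`. -/
def leftFrom (g : G) : TangentSpace I g →L[𝕜] GroupLieAlgebra I G :=
  mfderiv I I (fun h => g⁻¹ * h) g

/-- A vector field read in the left trivialization, as a function from `G` to its Lie algebra (whose
underlying vector space is `E`). -/
def leftTrivialized (σ : (g : G) → TangentSpace I g) (g : G) : E :=
  leftFrom (I := I) g (σ g)

/-- The differential of a vector field read in the left trivialization. -/
def leftDeriv (σ : (g : G) → TangentSpace I g) (g : G) :
    TangentSpace I g →L[𝕜] GroupLieAlgebra I G :=
  mvfderiv I (leftTrivialized σ) g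

theorem leftTo_leftFrom (g : G) (v : TangentSpace I g) :
    leftTo (I := I) g (leftFrom (I := I) g v) = v := by
  have hd (a b : G) : MDifferentiableAt I I (fun h => a * h) b :=
    (contMDiff_mul_left (n := ∞)).mdifferentiable (by simp) b
  have h1 : (fun h => g * h) ∘ (fun h => g⁻¹ * h) = id := by ext x; simp
  have h2 := mfderiv_comp (I := I) (I' := I) (I'' := I) g (hd g (g⁻¹ * g)) (hd g⁻¹ g)
  rw [h1, mfderiv_id] at h2
  have h3 := congrArg (fun L => L v) h2
  have h4 (a : G) (ha : a = 1) (w : E) :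
      (mfderiv I I (fun h => g * h) a : E →L[𝕜] E) w =
        (mfderiv I I (fun h => g * h) (1 : G) : E →L[𝕜] E) w := by subst ha; rfl
  exact (h3.trans (h4 _ (inv_mul_cancel g) _)).symm

theorem leftFrom_leftTo (g : G) (v : GroupLieAlgebra I G) :
    leftFrom (I := I) g (leftTo (I := I) g v) = v := by
  have hd (a b : G) : MDifferentiableAt I I (fun h => a * h) b :=
    (contMDiff_mul_left (n := ∞)).mdifferentiable (by simp) b
  have h1 : (fun h => g⁻¹ * h) ∘ (fun h => g * h) = id := by ext x; simp
  have h2 := mfderiv_comp (I := I) (I' := I) (I'' := I) (1 : G) (hd g⁻¹ (g * 1)) (hd g 1)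
  rw [h1, mfderiv_id] at h2
  have h3 := congrArg (fun L => L v) h2
  have h4 (a : G) (ha : a = g) (w : E) :
      (mfderiv I I (fun h => g⁻¹ * h) a : E →L[𝕜] E) w =
        (mfderiv I I (fun h => g⁻¹ * h) g : E →L[𝕜] E) w := by subst ha; rfl
  exact (h3.trans (h4 _ (mul_one g) _)).symm

theorem mdifferentiableAt_leftTrivialized {σ : (g : G) → TangentSpace I g} {g : G}
    (hσ : MDiffAt (T% σ) g) : MDifferentiableAt I 𝓘(𝕜, E) (leftTrivialized σ) g := by
  let F₁ : G → TangentBundle I G × TangentBundle I G :=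
    fun h => (TotalSpace.mk' E h⁻¹ 0, TotalSpace.mk' E h (σ h))
  have hz : ContMDiff I I.tangent ∞
      (fun h : G => (TotalSpace.mk' E h (0 : TangentSpace I h) : TangentBundle I G)) :=
    contMDiff_zeroSection _ _
  have S₁ : MDifferentiableAt I (I.tangent.prod I.tangent) F₁ g :=
    (((hz.comp (contMDiff_inv I ∞)).mdifferentiable (by simp)) g).prodMk hσ
  let F₂ : TangentBundle I G × TangentBundle I G → TangentBundle (I.prod I) (G × G) :=
    (equivTangentBundleProd I G I G).symm
  have S₂ : ContMDiff (I.tangent.prod I.tangent) (I.prod I).tangent ∞ F₂ :=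
    contMDiff_equivTangentBundleProd_symm
  let F₃ : TangentBundle (I.prod I) (G × G) → TangentBundle I G :=
    tangentMap (I.prod I) I (fun p : G × G => p.1 * p.2)
  have S₃ : ContMDiff (I.prod I).tangent I.tangent ∞ F₃ :=
    ContMDiff.contMDiff_tangentMap (n := ∞) (contMDiff_mul I ∞) (m := ∞) (by simp)
  have S := ((S₃.comp S₂).mdifferentiable (by simp) (F₁ g)).comp g S₁
  have hF : (F₃ ∘ F₂) ∘ F₁ = fun h => TotalSpace.mk' E
      (E := (TangentSpace I : G → Type _)) (h⁻¹ * h) (leftFrom (I := I) h (σ h)) := by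
    ext h
    · rfl
    · simp only [Function.comp_apply, tangentMap, F₃, F₂, F₁]
      rw [mfderiv_prod_eq_add_apply ((contMDiff_mul I ∞).mdifferentiable (by simp) _)]
      have e : (mfderiv I I (fun z : G => z * h) h⁻¹ : E →L[𝕜] E) 0 +
          (mfderiv I I (fun z : G => h⁻¹ * z) h : E →L[𝕜] E) (σ h) =
            leftFrom (I := I) h (σ h) := by
        rw [map_zero, zero_add]; rfl
      exact heq_of_eq e
  rw [hF] at S
  have hF' : (fun h : G => (TotalSpace.mk' E (E := (TangentSpace I : G → Type _)) (h⁻¹ * h)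
      (leftFrom (I := I) h (σ h)) : TangentBundle I G)) =
      fun h => TotalSpace.mk' E (E := (TangentSpace I : G → Type _)) (1 : G)
        (leftFrom (I := I) h (σ h)) := by
    ext h
    · simp
    · rfl
  rw [hF', mdifferentiableAt_totalSpace] at S
  convert! S.2 using 2 with h
  rw [TangentBundle.trivializationAt_apply]
  exact (tangentCoordChange_self (I := I) (x := (1 : G)) (z := (1 : G)) (by simp)).symm

theorem leftDeriv_add {σ τ : (g : G) → TangentSpace I g} {g : G}
    (hσ : MDiffAt (T% σ) g) (hτ : MDiffAt (T% τ) g) :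
    leftDeriv (σ + τ) g = leftDeriv σ g + leftDeriv τ g := by
  have h : leftTrivialized (σ + τ) = leftTrivialized σ + leftTrivialized τ := by
    ext g; exact (leftFrom (I := I) g).map_add _ _
  unfold leftDeriv
  rw [h]
  exact mvfderiv_add (mdifferentiableAt_leftTrivialized hσ) (mdifferentiableAt_leftTrivialized hτ)

theorem leftDeriv_smul {f : G → 𝕜} {σ : (g : G) → TangentSpace I g} {g : G}
    (hσ : MDiffAt (T% σ) g) (hf : MDiffAt f g) :
    leftDeriv (f • σ) g = f g • leftDeriv σ g + (mvfderiv I f g).smulRight (leftFrom g (σ g)) := by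
  have h : leftTrivialized (f • σ) = f • leftTrivialized σ := by
    ext g; exact (leftFrom (I := I) g).map_smul _ _
  unfold leftDeriv
  rw [h]
  exact mvfderiv_smul hf (mdifferentiableAt_leftTrivialized hσ)

section

variable [CompleteSpace E]

/-- The product `(u, v) ↦ ½ [u, v]`. -/
def halfBracket : GroupLieAlgebra I G →ₗ[𝕜] GroupLieAlgebra I G →ₗ[𝕜] GroupLieAlgebra I G :=
  LinearMap.mk₂ 𝕜 (fun u v => (1 / 2 : 𝕜) • ⁅u, v⁆)
    (fun u u' v => (congrArg ((1 / 2 : 𝕜) • ·) (add_lie u u' v)).trans (smul_add _ _ _))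
    (fun c u v => (congrArg ((1 / 2 : 𝕜) • ·) (smul_lie c u v)).trans (smul_comm _ _ _))
    (fun u v v' => (congrArg ((1 / 2 : 𝕜) • ·) (lie_add u v v')).trans (smul_add _ _ _))
    (fun c u v => (congrArg ((1 / 2 : 𝕜) • ·) (lie_smul c u v)).trans (smul_comm _ _ _))

/-- The product `α(u, v) = (∇_{u⁺} v⁺)(e)` on the Lie algebra. -/
def alphaOf (nabla : CovariantDerivative I E (TangentSpace I : G → Type _)) :
    GroupLieAlgebra I G →ₗ[𝕜] GroupLieAlgebra I G →ₗ[𝕜] GroupLieAlgebra I G :=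
  LinearMap.mk₂ 𝕜
    (fun u v => covField nabla (mulInvariantVectorField u) (mulInvariantVectorField v) 1)
    (by
      intro u u' v
      simp only [covField, mulInvariantVectorField_add, Pi.add_apply, map_add])
    (by
      intro c u v
      simp only [covField, mulInvariantVectorField_smul, Pi.smul_apply, map_smul])
    (by
      intro u v v'
      simp only [covField, mulInvariantVectorField_add]
      rw [nabla.isCovariantDerivativeOnUniv.add (mdifferentiableAt_mulInvariantVectorField v)
        (mdifferentiableAt_mulInvariantVectorField v')]
      rfl)
    (by
      intro c u v
      simp only [covField, mulInvariantVectorField_smul]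
      rw [nabla.isCovariantDerivativeOnUniv.smul_const c
        (mdifferentiableAt_mulInvariantVectorField v)]
      rfl)

/-- The product `u ∘ v = (∇_{u⁺} v⁺)(e) - ½ [u, v]` on the Lie algebra. -/
def productOf (nabla : CovariantDerivative I E (TangentSpace I : G → Type _)) :
    GroupLieAlgebra I G →ₗ[𝕜] GroupLieAlgebra I G →ₗ[𝕜] GroupLieAlgebra I G :=
  alphaOf nabla - halfBracket

end

variable [FiniteDimensional 𝕜 E]

instance finiteDimensional_groupLieAlgebra : FiniteDimensional 𝕜 (GroupLieAlgebra I G) :=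
  inferInstanceAs (FiniteDimensional 𝕜 E)

instance t2Space_groupLieAlgebra : T2Space (GroupLieAlgebra I G) :=
  inferInstanceAs (T2Space E)

/-- The left-invariant connection with `∇_{u⁺} v⁺ = (α u v)⁺` (see
`leftInvariantConnection_apply`). In the left trivialization a vector field is a function
`s : G → 𝔤`, and `∇_X s = ds(X) + α(X, s)`. -/
def leftInvariantConnection
    (α : GroupLieAlgebra I G →ₗ[𝕜] GroupLieAlgebra I G →ₗ[𝕜] GroupLieAlgebra I G) :
    CovariantDerivative I E (TangentSpace I : G → Type _) where
  toFun σ g := leftTo g ∘L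
    (leftDeriv σ g + (α.flip (leftFrom g (σ g))).toContinuousLinearMap ∘L leftFrom g)
  isCovariantDerivativeOnUniv :=
    { add := by
        intro σ τ g hσ hτ _
        rw [leftDeriv_add hσ hτ]
        ext v
        simp
        abel
      leibniz := by
        intro σ f g hσ hf _
        rw [leftDeriv_smul hσ hf]
        ext v
        simp [leftTo_leftFrom]
        module }

theorem leftInvariantConnection_apply
    (α : GroupLieAlgebra I G →ₗ[𝕜] GroupLieAlgebra I G →ₗ[𝕜] GroupLieAlgebra I G)
    (u v : GroupLieAlgebra I G) :
    covField (leftInvariantConnection α) (mulInvariantVectorField u) (mulInvariantVectorField v) =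
      mulInvariantVectorField (α u v) := by
  have hs : leftTrivialized (mulInvariantVectorField v : (g : G) → TangentSpace I g) =
      fun _ => v := by
    ext g; exact leftFrom_leftTo g v
  have hd (g : G) : leftDeriv (mulInvariantVectorField v : (g : G) → TangentSpace I g) g = 0 := by
    unfold leftDeriv
    rw [hs]
    exact mvfderiv_const (F := E) v
  ext g
  change leftTo g ((leftDeriv (mulInvariantVectorField v) g) (leftTo g u) +
    α (leftFrom g (leftTo g u)) (leftFrom g (leftTo g v))) = leftTo g (α u v)
  rw [hd, leftFrom_leftTo, leftFrom_leftTo]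
  simp

variable [CompleteSpace E]

/-- The connection `∇⁰` with `∇⁰_X Y = ½ [X, Y]` for left-invariant `X`, `Y`. -/
def nablaZero : CovariantDerivative I E (TangentSpace I : G → Type _) :=
  leftInvariantConnection halfBracket

/-- The left-invariant connection with `∇_{u⁺} v⁺ = ½ [u⁺, v⁺] + (u ∘ v)⁺`. -/
def connectionOf
    (mul : GroupLieAlgebra I G →ₗ[𝕜] GroupLieAlgebra I G →ₗ[𝕜] GroupLieAlgebra I G) :
    CovariantDerivative I E (TangentSpace I : G → Type _) :=
  leftInvariantConnection (halfBracket + mul)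

/-- Special connections: smooth, torsion free, bi-invariant, with the same curvature as `∇⁰`. -/
structure IsSpecial (nabla : CovariantDerivative I E (TangentSpace I : G → Type _)) : Prop where
  smooth : nabla.ContMDiffCovariantDerivative ∞
  torsionFree : nabla.torsion = 0
  biInvariant : IsBiInvariant nabla
  sameCurvature : SameCurvature nabla nablaZero

variable (I G) in
/-- The relation of being the same connection, on special connections. -/
def specialSetoid :
    Setoid {nabla : CovariantDerivative I E (TangentSpace I : G → Type _) // IsSpecial nabla} where
  r nabla nabla' := SameConnection nabla.1 nabla'.1
  iseqv :=
    { refl := fun _ _ _ => rfl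
      symm := fun h Y hY => (h Y hY).symm
      trans := fun h h' Y hY => (h Y hY).trans (h' Y hY) }

variable (I G) in
/-- The set of special connections. -/
def SpecialConnections := Quotient (specialSetoid I G)

/-- The element of `SpecialConnections I G` given by a special connection. -/
def SpecialConnections.mk (nabla : CovariantDerivative I E (TangentSpace I : G → Type _))
    (h : IsSpecial nabla) : SpecialConnections I G :=
  Quotient.mk (specialSetoid I G) ⟨nabla, h⟩

variable (I G) in
/-- The set of Poisson structures on the Lie algebra of `G`. -/
def PoissonProducts :=
  {mul : GroupLieAlgebra I G →ₗ[𝕜] GroupLieAlgebra I G →ₗ[𝕜] GroupLieAlgebra I G //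
    IsPoissonProduct mul}

end General

end LieConnection

end

open LieConnection

/-! ### Smoothness of translations, of invariant vector fields and of the left trivialization. -/

namespace LieConnection

section

variable {𝕜 : Type*} [RCLike 𝕜] {E : Type*} [NormedAddCommGroup E] [NormedSpace 𝕜 E]
  {H : Type*} [TopologicalSpace H] {I : ModelWithCorners 𝕜 E H}
  {G : Type*} [TopologicalSpace G] [ChartedSpace H G] [Group G] [LieGroup I ∞ G]

/-! In the left trivialization a vector field is a function `s : G → 𝔤`. A difference of two
connections is tensorial, so a left-invariant connection is determined by its constant product `α`
on left-invariant fields and has the form `∇_X s = ds(X) + α(X, s)` (`eq_leftInvariantConnection`).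
Write `α = ½[ , ] + ∘`. Each geometric condition then becomes an identity on the Lie algebra.

Torsion is a tensor, and on left-invariant fields it is `α(u, v) - α(v, u) - [u, v]`; it vanishes
exactly when `∘` is commutative. The curvatures of two such connections differ by the difference of
the algebraic expressions `α_u α_v - α_v α_u - α_[u,v]` (`leftFrom_curvatureField`). Once `∘` is
commutative and `ad` acts by derivations, comparison with `½[ , ]` leaves only the commutator of two
multiplications by `∘`, whose vanishing is associativity (`isPoissonProduct_iff_curvature`).

Right invariance means that `α` is equivariant under `Ad`, and the substantial point is that on a
connected group this is the derivation property of `ad`. It rests on the derivative of `g ↦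
Ad(g⁻¹)u` along `w⁺` being `-[w, Ad(g⁻¹)u]` (`leftDeriv_rightInvariantField`), which says that
left-invariant and right-invariant fields commute. That in turn is the symmetry of the second
derivative of the multiplication in a chart. Differentiating equivariance at the identity gives the
derivation property; conversely, the derivation property makes `Ad(g) α(Ad(g⁻¹)u, Ad(g⁻¹)v)` have
zero derivative, hence constant. Since `½[ , ]` satisfies the derivation property by Jacobi, the
condition passes to `∘`. -/

theorem mdifferentiableAt_mul_left (a b : G) : MDifferentiableAt I I (fun h => a * h) b :=
  (contMDiff_mul_left (n := ∞)).mdifferentiable (by simp) b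

theorem mdifferentiableAt_mul_right (a b : G) : MDifferentiableAt I I (fun h => h * a) b :=
  (contMDiff_mul_right (n := ∞)).mdifferentiable (by simp) b

/-- The differential of the group multiplication, as a map on pairs of tangent vectors. -/
theorem contMDiff_tangentMul :
    ContMDiff (I.tangent.prod I.tangent) I.tangent ∞
      (fun p : TangentBundle I G × TangentBundle I G =>
        (TotalSpace.mk' E (E := (TangentSpace I : G → Type _)) (p.1.proj * p.2.proj)
          ((mfderiv I I (fun z : G => z * p.2.proj) p.1.proj : E →L[𝕜] E) p.1.snd +
            (mfderiv I I (fun z : G => p.1.proj * z) p.2.proj : E →L[𝕜] E) p.2.snd) :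
          TangentBundle I G)) := by
  have S₂ : ContMDiff (I.tangent.prod I.tangent) (I.prod I).tangent ∞
      (equivTangentBundleProd I G I G).symm :=
    contMDiff_equivTangentBundleProd_symm
  have S₃ : ContMDiff (I.prod I).tangent I.tangent ∞
      (tangentMap (I.prod I) I (fun p : G × G => p.1 * p.2)) :=
    ContMDiff.contMDiff_tangentMap (n := ∞) (contMDiff_mul I ∞) (m := ∞) (by simp)
  convert! S₃.comp S₂ using 1
  ext p
  · rfl
  · simp only [Function.comp_apply, tangentMap]
    rw [mfderiv_prod_eq_add_apply ((contMDiff_mul I ∞).mdifferentiable (by simp) _)]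
    rfl

/-- The field is the tangent multiplication applied to the zero vector at `g` and the fixed vector
`v` at `1`. -/
theorem isSmoothField_mulInvariantVectorField (v : GroupLieAlgebra I G) :
    IsSmoothField (mulInvariantVectorField v : (g : G) → TangentSpace I g) := by
  have h : ContMDiff I (I.tangent.prod I.tangent) ∞ (fun g : G =>
      ((TotalSpace.mk' E g (0 : TangentSpace I g) : TangentBundle I G),
        (TotalSpace.mk' E (1 : G) v : TangentBundle I G))) :=
    (contMDiff_zeroSection 𝕜 (TangentSpace I : G → Type _)).prodMk contMDiff_const
  unfold IsSmoothField
  convert! contMDiff_tangentMul.comp h using 1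
  ext g
  · simp
  · refine heq_of_eq ?_
    change _ = (mfderiv I I (fun z : G => z * 1) g : E →L[𝕜] E) 0 +
      (mfderiv I I (fun z : G => g * z) 1 : E →L[𝕜] E) v
    rw [map_zero, zero_add]
    rfl

variable (I) in
/-- The right-invariant vector field with value `u` at the identity. -/
noncomputable def rightInvariantField (u : GroupLieAlgebra I G) (g : G) : TangentSpace I g :=
  (mfderiv I I (fun h => h * g) (1 : G) : E →L[𝕜] E) u

theorem isSmoothField_rightInvariantField (u : GroupLieAlgebra I G) :
    IsSmoothField (rightInvariantField I u : (g : G) → TangentSpace I g) := by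
  have h : ContMDiff I (I.tangent.prod I.tangent) ∞ (fun g : G =>
      ((TotalSpace.mk' E (1 : G) u : TangentBundle I G),
        (TotalSpace.mk' E g (0 : TangentSpace I g) : TangentBundle I G))) :=
    contMDiff_const.prodMk (contMDiff_zeroSection 𝕜 (TangentSpace I : G → Type _))
  unfold IsSmoothField
  convert! contMDiff_tangentMul.comp h using 1
  ext g
  · simp
  · refine heq_of_eq ?_
    change _ = (mfderiv I I (fun z : G => z * g) 1 : E →L[𝕜] E) u +
      (mfderiv I I (fun z : G => 1 * z) g : E →L[𝕜] E) 0
    rw [map_zero, add_zero]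
    rfl

/-- Tangent multiplication of the zero vector at `h⁻¹` with `σ h` lands in the single fibre over
`1`, where the preferred trivialization is the identity. -/
theorem contMDiff_leftTrivialized {σ : (g : G) → TangentSpace I g} (hσ : IsSmoothField σ) :
    ContMDiff I 𝓘(𝕜, E) ∞ (leftTrivialized σ) := by
  have hz : ContMDiff I I.tangent ∞
      (fun h : G => (TotalSpace.mk' E h (0 : TangentSpace I h) : TangentBundle I G)) :=
    contMDiff_zeroSection _ _
  have S := contMDiff_tangentMul.comp ((hz.comp (contMDiff_inv I ∞)).prodMk hσ)
  have hF : (fun h : G => (TotalSpace.mk' E (E := (TangentSpace I : G → Type _)) (1 : G)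
        (leftFrom (I := I) h (σ h)) : TangentBundle I G)) =
      (fun p : TangentBundle I G × TangentBundle I G =>
        (TotalSpace.mk' E (E := (TangentSpace I : G → Type _)) (p.1.proj * p.2.proj)
          ((mfderiv I I (fun z : G => z * p.2.proj) p.1.proj : E →L[𝕜] E) p.1.snd +
            (mfderiv I I (fun z : G => p.1.proj * z) p.2.proj : E →L[𝕜] E) p.2.snd) :
          TangentBundle I G)) ∘
        fun h : G => ((TotalSpace.mk' E h⁻¹ 0 : TangentBundle I G),
          (TotalSpace.mk' E h (σ h) : TangentBundle I G)) := by
    ext h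
    · simp
    · refine heq_of_eq ?_
      change _ = (mfderiv I I (fun z : G => z * h) h⁻¹ : E →L[𝕜] E) 0 +
        (mfderiv I I (fun z : G => h⁻¹ * z) h : E →L[𝕜] E) (σ h)
      rw [map_zero, zero_add]
      rfl
  replace S := hF ▸ S
  intro g
  have S' := (contMDiffAt_totalSpace.1 (S g)).2
  convert! S' using 2 with h
  rw [TangentBundle.trivializationAt_apply]
  exact (tangentCoordChange_self (I := I) (x := (1 : G)) (z := (1 : G)) (by simp)).symm

end

end LieConnection

/-! ### Left-invariant and right-invariant fields commute at the identity: computation in a chart.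
-/

namespace LieConnection

open Set Filter Topology

/-- The bracket is `D²μ((0,w),(u,0)) - D²μ((u,0),(0,w))`, zero by symmetry. The hypotheses `hl` and
`hr`, infinitesimal forms of the unit laws, identify the values of the two fields at `c`. -/
theorem lieBracket_partial_fderiv_eq_zero {𝕜 : Type*} [RCLike 𝕜] {E : Type*}
    [NormedAddCommGroup E] [NormedSpace 𝕜 E] {μ : E × E → E} {c u w : E}
    (hμ : ContDiffAt 𝕜 2 μ (c, c))
    (hl : fderiv 𝕜 μ (c, c) (0, w) = w) (hr : fderiv 𝕜 μ (c, c) (u, 0) = u) :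
    lieBracket 𝕜 (fun y => fderiv 𝕜 μ (y, c) (0, w)) (fun y => fderiv 𝕜 μ (c, y) (u, 0)) c = 0 := by
  have hsymm : IsSymmSndFDerivAt 𝕜 μ (c, c) :=
    hμ.isSymmSndFDerivAt (by simp)
  have hd : HasFDerivAt (fderiv 𝕜 μ) (fderiv 𝕜 (fderiv 𝕜 μ) (c, c)) (c, c) :=
    ((hμ.fderiv_right (m := 1) (by norm_num)).differentiableAt (by simp)).hasFDerivAt
  have h1 : HasFDerivAt (fun y => fderiv 𝕜 μ (y, c) (0, w))
      ((ContinuousLinearMap.apply 𝕜 E ((0, w) : E × E)) ∘L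
        (fderiv 𝕜 (fderiv 𝕜 μ) (c, c) ∘L ContinuousLinearMap.inl 𝕜 E E)) c :=
    (ContinuousLinearMap.apply 𝕜 E ((0, w) : E × E)).hasFDerivAt.comp c
      (HasFDerivAt.comp c (f := fun y : E => (y, c)) hd (hasFDerivAt_prodMk_left c c))
  have h2 : HasFDerivAt (fun y => fderiv 𝕜 μ (c, y) (u, 0))
      ((ContinuousLinearMap.apply 𝕜 E ((u, 0) : E × E)) ∘L
        (fderiv 𝕜 (fderiv 𝕜 μ) (c, c) ∘L ContinuousLinearMap.inr 𝕜 E E)) c :=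
    (ContinuousLinearMap.apply 𝕜 E ((u, 0) : E × E)).hasFDerivAt.comp c
      (HasFDerivAt.comp c (f := fun y : E => (c, y)) hd (hasFDerivAt_prodMk_right c c))
  rw [lieBracket, h1.fderiv, h2.fderiv, hl, hr]
  simp [hsymm (0, w) (u, 0)]

section

variable {𝕜 : Type*} [RCLike 𝕜] {E : Type*} [NormedAddCommGroup E] [NormedSpace 𝕜 E]
  {H : Type*} [TopologicalSpace H] {I : ModelWithCorners 𝕜 E H}
  {G : Type*} [TopologicalSpace G] [ChartedSpace H G]

theorem inverse_mfderivWithin_extChartAt_symm [IsManifold I 1 G] {x : G} {y : E}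
    (hy : y ∈ (extChartAt I x).target) :
    (mfderivWithin 𝓘(𝕜, E) I (extChartAt I x).symm (range I) y).inverse =
      mfderiv I 𝓘(𝕜, E) (extChartAt I x) ((extChartAt I x).symm y) :=
  ContinuousLinearMap.inverse_eq
    (mfderivWithin_extChartAt_symm_comp_mfderiv_extChartAt hy)
    (mfderiv_extChartAt_comp_mfderivWithin_extChartAt_symm hy)

variable [Group G]

theorem mulInvariantVectorField_one (w : GroupLieAlgebra I G) :
    (mulInvariantVectorField w (1 : G) : E) = w := by
  have h : (fun h : G => 1 * h) = id := funext one_mul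
  rw [mulInvariantVectorField, h, mfderiv_id]
  rfl

theorem rightInvariantField_one (u : GroupLieAlgebra I G) :
    (rightInvariantField I u (1 : G) : E) = u := by
  have h : (fun h : G => h * 1) = id := funext mul_one
  rw [rightInvariantField, h, mfderiv_id]
  rfl

variable [I.Boundaryless] [LieGroup I ∞ G]

variable (I G) in
/-- The multiplication of a Lie group read in the chart at the identity. -/
noncomputable def chartMul (p : E × E) : E :=
  extChartAt I (1 : G) ((extChartAt I (1 : G)).symm p.1 * (extChartAt I (1 : G)).symm p.2)

theorem hasMFDerivAt_extChartAt_symm_one :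
    HasMFDerivAt 𝓘(𝕜, E) I (extChartAt I (1 : G)).symm (extChartAt I (1 : G) 1)
      (ContinuousLinearMap.id 𝕜 E) := by
  have h := (contMDiffOn_extChartAt_symm (I := I) (n := ∞) (1 : G)).contMDiffAt
    (extChartAt_target_mem_nhds (I := I) (1 : G)) |>.mdifferentiableAt (by simp) |>.hasMFDerivAt
  have h2 := mfderivWithin_extChartAt_symm_comp_mfderiv_extChartAt' (I := I)
    (mem_extChartAt_source (I := I) (1 : G))
  rw [I.range_eq_univ, mfderivWithin_univ, mfderiv_extChartAt_self] at h2
  have h3 : (mfderiv 𝓘(𝕜, E) I (extChartAt I (1 : G)).symm (extChartAt I (1 : G) 1) :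
      E →L[𝕜] E) = ContinuousLinearMap.id 𝕜 E := h2
  rw [← h3]
  exact h

theorem contDiffAt_chartMul :
    ContDiffAt 𝕜 2 (chartMul I G) (extChartAt I (1 : G) 1, extChartAt I (1 : G) 1) := by
  rw [← contMDiffAt_iff_contDiffAt]
  set c := extChartAt I (1 : G) 1 with hc
  have hs : ContMDiffAt 𝓘(𝕜, E) I 2 (extChartAt I (1 : G)).symm c :=
    (contMDiffOn_extChartAt_symm (I := I) (n := 2) (1 : G)).contMDiffAt
      (extChartAt_target_mem_nhds (I := I) (1 : G))
  have h1 : (extChartAt I (1 : G)).symm c = 1 := extChartAt_to_inv (I := I) (1 : G)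
  have hp : ContMDiffAt 𝓘(𝕜, E × E) I 2
      (fun p : E × E => (extChartAt I (1 : G)).symm p.1 * (extChartAt I (1 : G)).symm p.2)
      (c, c) := by
    have a1 : ContMDiffAt 𝓘(𝕜, E × E) I 2 (fun p : E × E => (extChartAt I (1 : G)).symm p.1)
        (c, c) := ContMDiffAt.comp (c, c) (g := (extChartAt I (1 : G)).symm) hs
          contDiff_fst.contMDiff.contMDiffAt
    have a2 : ContMDiffAt 𝓘(𝕜, E × E) I 2 (fun p : E × E => (extChartAt I (1 : G)).symm p.2)
        (c, c) := ContMDiffAt.comp (c, c) (g := (extChartAt I (1 : G)).symm) hs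
          contDiff_snd.contMDiff.contMDiffAt
    exact (((contMDiff_mul I ∞).of_le ENat.LEInfty.out).contMDiffAt).comp (c, c)
      (a1.prodMk a2)
  refine ContMDiffAt.comp_of_eq (g := extChartAt I (1 : G)) (contMDiffAt_extChartAt (x := (1 : G)))
    hp ?_
  rw [h1, mul_one]

/-- Both sides differentiate `h ↦ y * h` at the unit; the inverse chart contributes nothing because
its derivative at the base point is the identity. -/
theorem fderiv_chartMul_right {y w : E} (hy : y ∈ (extChartAt I (1 : G)).target)
    (hd : DifferentiableAt 𝕜 (chartMul I G) (y, extChartAt I (1 : G) 1)) :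
    fderiv 𝕜 (chartMul I G) (y, extChartAt I (1 : G) 1) (0, w) =
      mpullbackWithin 𝓘(𝕜, E) I (extChartAt I (1 : G)).symm (mulInvariantVectorField w)
        (range I) y := by
  set φ := extChartAt I (1 : G) with hφ
  have h1 : φ.symm (φ 1) = 1 := extChartAt_to_inv (I := I) (1 : G)
  have hφd : MDifferentiableAt I 𝓘(𝕜, E) φ (φ.symm y * 1) := by
    rw [mul_one]
    exact mdifferentiableAt_extChartAt (by simpa [hφ] using φ.map_target hy)
  have hF : HasMFDerivAt I 𝓘(𝕜, E) (fun h => φ (φ.symm y * h)) (1 : G)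
      ((mfderiv I 𝓘(𝕜, E) φ (φ.symm y * 1) : E →L[𝕜] E) ∘L
        (mfderiv I I (fun h => φ.symm y * h) (1 : G) : E →L[𝕜] E)) :=
    hφd.hasMFDerivAt.comp (1 : G) (mdifferentiableAt_mul_left (φ.symm y) 1).hasMFDerivAt
  have hF' : HasMFDerivAt I 𝓘(𝕜, E) (fun h => φ (φ.symm y * h)) (φ.symm (φ 1))
      ((mfderiv I 𝓘(𝕜, E) φ (φ.symm y * 1) : E →L[𝕜] E) ∘L
        (mfderiv I I (fun h => φ.symm y * h) (1 : G) : E →L[𝕜] E)) := by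
    rw [h1]; exact hF
  have hc := (hF'.comp (φ 1) hasMFDerivAt_extChartAt_symm_one).hasFDerivAt
  have hc' := hd.hasFDerivAt.comp (φ 1) (hasFDerivAt_prodMk_right y (φ 1))
  have he := congrArg (fun L : E →L[𝕜] E => L w) (hc'.unique hc)
  have e (a : G) (ha : a = φ.symm y) (v : E) :
      (mfderiv I 𝓘(𝕜, E) φ a : E →L[𝕜] E) v =
        (mfderiv I 𝓘(𝕜, E) φ (φ.symm y) : E →L[𝕜] E) v := by subst ha; rfl
  rw [mpullbackWithin, inverse_mfderivWithin_extChartAt_symm hy]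
  exact he.trans (e _ (mul_one _) _)

theorem fderiv_chartMul_left {y u : E} (hy : y ∈ (extChartAt I (1 : G)).target)
    (hd : DifferentiableAt 𝕜 (chartMul I G) (extChartAt I (1 : G) 1, y)) :
    fderiv 𝕜 (chartMul I G) (extChartAt I (1 : G) 1, y) (u, 0) =
      mpullbackWithin 𝓘(𝕜, E) I (extChartAt I (1 : G)).symm (rightInvariantField I u)
        (range I) y := by
  set φ := extChartAt I (1 : G) with hφ
  have h1 : φ.symm (φ 1) = 1 := extChartAt_to_inv (I := I) (1 : G)
  have hφd : MDifferentiableAt I 𝓘(𝕜, E) φ (1 * φ.symm y) := by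
    rw [one_mul]
    exact mdifferentiableAt_extChartAt (by simpa [hφ] using φ.map_target hy)
  have hF : HasMFDerivAt I 𝓘(𝕜, E) (fun h => φ (h * φ.symm y)) (1 : G)
      ((mfderiv I 𝓘(𝕜, E) φ (1 * φ.symm y) : E →L[𝕜] E) ∘L
        (mfderiv I I (fun h => h * φ.symm y) (1 : G) : E →L[𝕜] E)) :=
    hφd.hasMFDerivAt.comp (1 : G) (mdifferentiableAt_mul_right (φ.symm y) 1).hasMFDerivAt
  have hF' : HasMFDerivAt I 𝓘(𝕜, E) (fun h => φ (h * φ.symm y)) (φ.symm (φ 1))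
      ((mfderiv I 𝓘(𝕜, E) φ (1 * φ.symm y) : E →L[𝕜] E) ∘L
        (mfderiv I I (fun h => h * φ.symm y) (1 : G) : E →L[𝕜] E)) := by
    rw [h1]; exact hF
  have hc := (hF'.comp (φ 1) hasMFDerivAt_extChartAt_symm_one).hasFDerivAt
  have hc' := HasFDerivAt.comp (φ 1) (f := fun z : E => (z, y)) hd.hasFDerivAt
    (hasFDerivAt_prodMk_left (φ 1) y)
  have he := congrArg (fun L : E →L[𝕜] E => L u) (hc'.unique hc)
  have e (a : G) (ha : a = φ.symm y) (v : E) :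
      (mfderiv I 𝓘(𝕜, E) φ a : E →L[𝕜] E) v =
        (mfderiv I 𝓘(𝕜, E) φ (φ.symm y) : E →L[𝕜] E) v := by subst ha; rfl
  rw [mpullbackWithin, inverse_mfderivWithin_extChartAt_symm hy]
  exact he.trans (e _ (one_mul _) _)

theorem mlieBracket_mulInvariant_rightInvariant_one (w u : GroupLieAlgebra I G) :
    mlieBracket I (mulInvariantVectorField w) (rightInvariantField I u) (1 : G) = 0 := by
  set φ := extChartAt I (1 : G) with hφ
  set c := φ 1 with hc
  have hμ : ContDiffAt 𝕜 2 (chartMul I G) (c, c) := contDiffAt_chartMul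
  have hev : ∀ᶠ p in 𝓝 (c, c), DifferentiableAt 𝕜 (chartMul I G) p :=
    (hμ.eventually (by simp)).mono fun p hp => hp.differentiableAt (by simp)
  have ht : ∀ᶠ y in 𝓝 c, y ∈ φ.target := extChartAt_target_mem_nhds (I := I) (1 : G)
  have hl : (mpullbackWithin 𝓘(𝕜, E) I φ.symm (mulInvariantVectorField w) (range I) : E → E)
      =ᶠ[𝓝 c] fun y => fderiv 𝕜 (chartMul I G) (y, c) (0, w) := by
    filter_upwards [ht, (Continuous.prodMk_left c).continuousAt.eventually hev] with y hy hy'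
    exact (fderiv_chartMul_right hy hy').symm
  have hr : (mpullbackWithin 𝓘(𝕜, E) I φ.symm (rightInvariantField I u) (range I) : E → E)
      =ᶠ[𝓝 c] fun y => fderiv 𝕜 (chartMul I G) (c, y) (u, 0) := by
    filter_upwards [ht, (Continuous.prodMk_right c).continuousAt.eventually hev] with y hy hy'
    exact (fderiv_chartMul_left hy hy').symm
  have h1 : φ.symm c = 1 := extChartAt_to_inv (I := I) (1 : G)
  have hval (V : (g : G) → TangentSpace I g) :
      (mpullbackWithin 𝓘(𝕜, E) I φ.symm V (range I) c : E) = V 1 := by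
    rw [mpullbackWithin, inverse_mfderivWithin_extChartAt_symm ht.self_of_nhds]
    have e (a : G) (ha : a = 1) :
        ((mfderiv I 𝓘(𝕜, E) φ a : E →L[𝕜] E) (V a) : E) = V 1 := by
      subst ha
      have := mfderiv_extChartAt_self (I := I) (x := (1 : G))
      exact congrArg (fun L : E →L[𝕜] E => L (V 1)) this
    exact e _ h1
  have hzero := lieBracket_partial_fderiv_eq_zero hμ
    (hl.self_of_nhds.symm.trans ((hval _).trans (mulInvariantVectorField_one w)))
    (hr.self_of_nhds.symm.trans ((hval _).trans (rightInvariantField_one u)))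
  have hu (V W : E → E) (h : lieBracket 𝕜 V W c = 0) :
      lieBracketWithin 𝕜 V W (φ.symm ⁻¹' univ ∩ range I) c = 0 := by
    rwa [preimage_univ, univ_inter, I.range_eq_univ, lieBracketWithin_univ]
  have hz := hu _ _ ((Filter.EventuallyEq.lieBracket_vectorField_eq (𝕜 := 𝕜) hl hr).trans hzero)
  exact (congrArg (mfderiv I 𝓘(𝕜, E) φ (1 : G)).inverse hz).trans (map_zero _)

end
end LieConnection

/-! ### The adjoint representation and the action of translations on vector fields. -/

namespace LieConnection

section

variable {𝕜 : Type*} [RCLike 𝕜] {E : Type*} [NormedAddCommGroup E] [NormedSpace 𝕜 E]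
  {H : Type*} [TopologicalSpace H] {I : ModelWithCorners 𝕜 E H}
  {G : Type*} [TopologicalSpace G] [ChartedSpace H G]

/-- The chain rule with vectors read in `E` and with the base point and the composite given by
equations, so that group identities can be used without transporting between tangent spaces. -/
theorem mfderiv_apply_mfderiv {f g k : G → G} {x y : G} (hg : MDifferentiableAt I I g y)
    (hf : MDifferentiableAt I I f x) (hy : f x = y) (hk : ∀ z, g (f z) = k z) (v : E) :
    (mfderiv I I g y : E →L[𝕜] E) ((mfderiv I I f x : E →L[𝕜] E) v) =
      (mfderiv I I k x : E →L[𝕜] E) v := by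
  subst hy
  obtain rfl : g ∘ f = k := funext hk
  exact (congrArg (fun L : E →L[𝕜] E => L v) (mfderiv_comp x hg hf)).symm

theorem mfderiv_id_apply (x : G) (v : E) :
    (mfderiv I I (fun z : G => z) x : E →L[𝕜] E) v = v :=
  congrArg (fun L : E →L[𝕜] E => L v) (mfderiv_id (I := I) (x := x))

variable [Group G]

variable (I) in
/-- The adjoint representation. -/
noncomputable def adjoint (a : G) : GroupLieAlgebra I G →L[𝕜] GroupLieAlgebra I G :=
  (mfderiv I I (fun h => a * h * a⁻¹) (1 : G) : E →L[𝕜] E)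

theorem adjoint_one (u : GroupLieAlgebra I G) : adjoint I (1 : G) u = u := by
  have e : (fun z : G => 1 * z * 1⁻¹) = fun z => z := by
    ext z; group
  rw [adjoint, e]
  exact mfderiv_id_apply _ _

variable [LieGroup I ∞ G]

theorem mfderiv_mul_right_comp_mfderiv_inv (a g : G) :
    (mfderiv I I (fun h => h * a) g : E →L[𝕜] E) ∘L
      (mfderiv I I (fun h => h * a⁻¹) (g * a) : E →L[𝕜] E) = ContinuousLinearMap.id 𝕜 E := by
  ext v
  exact (mfderiv_apply_mfderiv (E := E) (k := fun z => z) (mdifferentiableAt_mul_right a g)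
    (mdifferentiableAt_mul_right a⁻¹ (g * a)) (by simp) (by simp) v).trans (mfderiv_id_apply (E := E) _ _)

theorem mfderiv_mul_right_inv_comp_mfderiv (a g : G) :
    (mfderiv I I (fun h => h * a⁻¹) (g * a) : E →L[𝕜] E) ∘L
      (mfderiv I I (fun h => h * a) g : E →L[𝕜] E) = ContinuousLinearMap.id 𝕜 E := by
  ext v
  exact (mfderiv_apply_mfderiv (E := E) (k := fun z => z) (mdifferentiableAt_mul_right a⁻¹ (g * a))
    (mdifferentiableAt_mul_right a g) rfl (by simp) v).trans (mfderiv_id_apply (E := E) _ _)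

theorem inverse_mfderiv_mul_right (a g : G) :
    ((mfderiv I I (fun h => h * a) g).inverse : E →L[𝕜] E) =
      mfderiv I I (fun h => h * a⁻¹) (g * a) :=
  ContinuousLinearMap.inverse_eq (M := E) (M₂ := E)
    (mfderiv_mul_right_comp_mfderiv_inv a g) (mfderiv_mul_right_inv_comp_mfderiv a g)

theorem isInvertible_mfderiv_mul_right (a g : G) :
    (mfderiv I I (fun h => h * a) g).IsInvertible :=
  ContinuousLinearMap.IsInvertible.of_inverse (M := E) (M₂ := E)
    (mfderiv_mul_right_comp_mfderiv_inv a g) (mfderiv_mul_right_inv_comp_mfderiv a g)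

theorem isInvertible_mfderiv_mul_left (a g : G) :
    (mfderiv I I (fun h => a * h) g).IsInvertible := by
  refine ContinuousLinearMap.IsInvertible.of_inverse (M := E) (M₂ := E)
    (g := (mfderiv I I (fun h => a⁻¹ * h) (a * g) : E →L[𝕜] E)) ?_ ?_
  · ext v
    exact (mfderiv_apply_mfderiv (E := E) (k := fun z => z) (mdifferentiableAt_mul_left a g)
      (mdifferentiableAt_mul_left a⁻¹ (a * g)) (by simp) (by simp) v).trans (mfderiv_id_apply (E := E) _ _)
  · ext v
    exact (mfderiv_apply_mfderiv (E := E) (k := fun z => z) (mdifferentiableAt_mul_left a⁻¹ (a * g))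
      (mdifferentiableAt_mul_left a g) rfl (by simp) v).trans (mfderiv_id_apply (E := E) _ _)

theorem isSmoothField_mpullback_mul_left (a : G) {X : (g : G) → TangentSpace I g}
    (hX : IsSmoothField X) : IsSmoothField (mpullback I I (fun g => a * g) X) := by
  have h := (ContMDiff.contMDiff_tangentMap (n := ∞) (m := ∞)
    (contMDiff_mul_left (I := I) (n := ∞) (a := a⁻¹)) (by simp)).comp
      (hX.comp (contMDiff_mul_left (I := I) (n := ∞) (a := a)))
  unfold IsSmoothField
  convert! h using 1
  ext g
  · simp [tangentMap]
  · refine heq_of_eq ?_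
    simp only [mpullback, inverse_mfderiv_mul_left]
    rfl

theorem isSmoothField_mpullback_mul_right (a : G) {X : (g : G) → TangentSpace I g}
    (hX : IsSmoothField X) : IsSmoothField (mpullback I I (fun g => g * a) X) := by
  have h := (ContMDiff.contMDiff_tangentMap (n := ∞) (m := ∞)
    (contMDiff_mul_right (I := I) (n := ∞) (a := a⁻¹)) (by simp)).comp
      (hX.comp (contMDiff_mul_right (I := I) (n := ∞) (a := a)))
  unfold IsSmoothField
  convert! h using 1
  ext g
  · simp [tangentMap]
  · refine heq_of_eq ?_
    exact congrArg (fun L : E →L[𝕜] E => L (X (g * a))) (inverse_mfderiv_mul_right a g)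

theorem mdifferentiableAt_conj (a : G) :
    MDifferentiableAt I I (fun z => a * z * a⁻¹) (1 : G) :=
  (mdifferentiableAt_mul_right (I := I) a⁻¹ (a * 1)).comp (1 : G)
    (mdifferentiableAt_mul_left (I := I) a 1)

theorem eq_of_leftFrom_eq {X Y : (g : G) → TangentSpace I g}
    (h : ∀ g, leftFrom (I := I) g (X g) = leftFrom (I := I) g (Y g)) : X = Y := by
  funext g
  rw [← leftTo_leftFrom g (X g), h, leftTo_leftFrom]

theorem leftFrom_mulInvariantVectorField (v : GroupLieAlgebra I G) (g : G) :
    leftFrom (I := I) g (mulInvariantVectorField v g) = v :=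
  leftFrom_leftTo g v

theorem leftFrom_mpullback_mul_left (a : G) (X : (g : G) → TangentSpace I g) (g : G) :
    leftFrom (I := I) g (mpullback I I (fun h => a * h) X g) =
      leftFrom (I := I) (a * g) (X (a * g)) := by
  have h := mfderiv_apply_mfderiv (E := E) (x := a * g) (k := fun z => (a * g)⁻¹ * z)
    (mdifferentiableAt_mul_left (I := I) g⁻¹ g)
    (mdifferentiableAt_mul_left (I := I) a⁻¹ (a * g)) (by simp) (by simp [mul_assoc]) (X (a * g))
  simp only [mpullback, inverse_mfderiv_mul_left]
  exact h

theorem leftFrom_mpullback_mul_right (a : G) (X : (g : G) → TangentSpace I g) (g : G) :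
    leftFrom (I := I) g (mpullback I I (fun h => h * a) X g) =
      adjoint I a (leftFrom (I := I) (g * a) (X (g * a))) := by
  have h1 := mfderiv_apply_mfderiv (E := E) (x := g * a) (k := fun z => g⁻¹ * (z * a⁻¹))
    (mdifferentiableAt_mul_left (I := I) g⁻¹ g)
    (mdifferentiableAt_mul_right (I := I) a⁻¹ (g * a)) (by simp) (fun _ => rfl) (X (g * a))
  -- The map `z ↦ g⁻¹ z a⁻¹` is factored a second time, as conjugation by `a` after left translation
  -- by `(g a)⁻¹`.
  have h2 := mfderiv_apply_mfderiv (E := E) (x := g * a) (k := fun z => g⁻¹ * (z * a⁻¹))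
    (mdifferentiableAt_conj a)
    (mdifferentiableAt_mul_left (I := I) (g * a)⁻¹ (g * a)) (by simp) (fun z => by group)
    (X (g * a))
  have h3 := congrArg (fun L : E →L[𝕜] E => L (X (g * a))) (inverse_mfderiv_mul_right (I := I) a g)
  exact (congrArg (mfderiv I I (fun h => g⁻¹ * h) g : E →L[𝕜] E) h3).trans (h1.trans h2.symm)

theorem leftFrom_rightInvariantField (u : GroupLieAlgebra I G) (g : G) :
    leftFrom (I := I) g (rightInvariantField I u g) = adjoint I g⁻¹ u := by
  exact mfderiv_apply_mfderiv (E := E) (x := (1 : G)) (mdifferentiableAt_mul_left (I := I) g⁻¹ g)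
    (mdifferentiableAt_mul_right (I := I) g 1) (by simp) (fun z => by simp [mul_assoc]) u

theorem adjoint_mul (a b : G) (u : GroupLieAlgebra I G) :
    adjoint I (a * b) u = adjoint I a (adjoint I b u) :=
  (mfderiv_apply_mfderiv (E := E) (x := (1 : G)) (k := fun z => a * b * z * (a * b)⁻¹)
    (mdifferentiableAt_conj a) (mdifferentiableAt_conj b) (by simp) (fun z => by group) u).symm

theorem mpullback_mul_left_rightInvariantField (a : G) (u : GroupLieAlgebra I G) :
    mpullback I I (fun h => a * h) (rightInvariantField I u) =
      rightInvariantField I (adjoint I a⁻¹ u) := by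
  apply eq_of_leftFrom_eq
  intro g
  rw [leftFrom_mpullback_mul_left, leftFrom_rightInvariantField,
    leftFrom_rightInvariantField, mul_inv_rev, adjoint_mul]

theorem IsSmoothField.mdifferentiableAt {X : (g : G) → TangentSpace I g} (hX : IsSmoothField X)
    (g : G) : MDiffAt (T% X) g :=
  ContMDiff.mdifferentiable hX (by simp) g

variable [I.Boundaryless] [CompleteSpace E]

/-- Pulling back by left translation fixes `w⁺` and turns a right-invariant field into another one,
so vanishing at `1` for every right-invariant field spreads to all of `G`. -/
theorem mlieBracket_mulInvariant_rightInvariant (w u : GroupLieAlgebra I G) :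
    mlieBracket I (mulInvariantVectorField w) (rightInvariantField I u) =
      (0 : (g : G) → TangentSpace I g) := by
  apply eq_of_leftFrom_eq
  intro g
  have h := mpullback_mlieBracket (I := I) (I' := I) (n := ∞) (x₀ := (1 : G)) (f := fun h => g * h)
    ((isSmoothField_mulInvariantVectorField w).mdifferentiableAt _)
    ((isSmoothField_rightInvariantField (I := I) u).mdifferentiableAt _)
    (contMDiff_mul_left (I := I) (n := ∞) (a := g)).contMDiffAt
    (by simpa using ENat.LEInfty.out)
  rw [mpullback_mulInvariantVectorField, mpullback_mul_left_rightInvariantField,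
    mlieBracket_mulInvariant_rightInvariant_one] at h
  have h' := leftFrom_mpullback_mul_left g
    (mlieBracket I (mulInvariantVectorField w) (rightInvariantField I u)) 1
  rw [mul_one] at h'
  rw [← h', h, map_zero]
  exact (map_zero (leftFrom (I := I) g)).symm

end
end LieConnection

/-! ### Calculus: conjugated bilinear maps, vanishing derivatives, operator-valued maps. -/

namespace LieConnection

section

open Set Filter Topology

set_option synthInstance.maxHeartbeats 200000 in
-- In the direction `D * L` the derivative is `L⁻¹` applied to `B(DLu, Lv) + B(Lu, DLv) - D B(Lu,
-- Lv)`, which is the defect of `D` from being a derivation of `B`.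
theorem exists_hasFDerivAt_conj_bilinear {𝕜 : Type*} [NontriviallyNormedField 𝕜] {E : Type*}
    [NormedAddCommGroup E] [NormedSpace 𝕜 E] [CompleteSpace E] (B : E →L[𝕜] E →L[𝕜] E)
    (L : (E →L[𝕜] E)ˣ) (u v : E) :
    ∃ Ψ' : (E →L[𝕜] E) →L[𝕜] E,
      HasFDerivAt (fun M : E →L[𝕜] E => Ring.inverse M (B (M u) (M v))) Ψ' L ∧
        ∀ D : E →L[𝕜] E, (∀ x y, D (B x y) = B (D x) y + B x (D y)) → Ψ' (D * L) = 0 := by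
  have hu : HasFDerivAt (fun M : E →L[𝕜] E => M u) (ContinuousLinearMap.apply 𝕜 E u)
      (L : E →L[𝕜] E) := (ContinuousLinearMap.apply 𝕜 E u).hasFDerivAt
  have hv : HasFDerivAt (fun M : E →L[𝕜] E => M v) (ContinuousLinearMap.apply 𝕜 E v)
      (L : E →L[𝕜] E) := (ContinuousLinearMap.apply 𝕜 E v).hasFDerivAt
  have hB := (B.hasFDerivAt.comp (L : E →L[𝕜] E) hu).clm_apply hv
  have hI : HasFDerivAt Ring.inverse _ (L : E →L[𝕜] E) :=
    hasFDerivAt_ringInverse (𝕜 := 𝕜) L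
  refine ⟨_, hI.clm_apply hB, fun D hD => ?_⟩
  have h1 (x : E) : (↑L⁻¹ : E →L[𝕜] E) ((L : E →L[𝕜] E) x) = x :=
    congrArg (fun M : E →L[𝕜] E => M x) L.inv_mul
  have h2 (x : E) : (L : E →L[𝕜] E) ((↑L⁻¹ : E →L[𝕜] E) x) = x :=
    congrArg (fun M : E →L[𝕜] E => M x) L.mul_inv
  simp [h2, hD]
  abel

variable {𝕜 : Type*} [RCLike 𝕜] {E : Type*} [NormedAddCommGroup E] [NormedSpace 𝕜 E]
  {H : Type*} [TopologicalSpace H] {I : ModelWithCorners 𝕜 E H}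
  {G : Type*} [TopologicalSpace G] [ChartedSpace H G]
  {F : Type*} [NormedAddCommGroup F] [NormedSpace 𝕜 F]

theorem eq_of_mfderiv_eq_zero [I.Boundaryless] [IsManifold I 1 G] [PreconnectedSpace G] {f : G → F}
    (hf : MDifferentiable I 𝓘(𝕜, F) f) (hf' : ∀ x, mfderiv I 𝓘(𝕜, F) f x = 0) (x y : G) :
    f x = f y := by
  -- Real scalars serve only to make balls in the chart convex, hence preconnected.
  let _ : NormedSpace ℝ E := NormedSpace.restrictScalars ℝ 𝕜 E
  have hloc : IsLocallyConstant f := by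
    rw [IsLocallyConstant.iff_eventually_eq]
    intro x
    set φ := extChartAt I x with hφ
    obtain ⟨r, hr, hball⟩ := Metric.mem_nhds_iff.1 (extChartAt_target_mem_nhds (I := I) x)
    have hd (z : E) (hz : z ∈ Metric.ball (φ x) r) : HasFDerivAt (f ∘ φ.symm) (0 : E →L[𝕜] F) z := by
      have h1 : MDifferentiableAt 𝓘(𝕜, E) I φ.symm z :=
        ((contMDiffOn_extChartAt_symm (I := I) (n := 1) x).contMDiffAt
          (extChartAt_target_mem_nhds' (I := I) (hball hz))).mdifferentiableAt (by simp)
      have h2 := (hf (φ.symm z)).hasMFDerivAt.comp z h1.hasMFDerivAt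
      rw [hf'] at h2
      have h3 := h2.hasFDerivAt
      exact h3.congr_fderiv (ContinuousLinearMap.zero_comp _)
    have hc : ∀ z ∈ Metric.ball (φ x) r, (f ∘ φ.symm) z = (f ∘ φ.symm) (φ x) := fun z hz =>
      Metric.isOpen_ball.is_const_of_fderiv_eq_zero (𝕜 := 𝕜) (convex_ball (φ x) r).isPreconnected
        (fun z hz => (hd z hz).differentiableAt.differentiableWithinAt)
        (fun z hz => (hd z hz).fderiv) hz (Metric.mem_ball_self hr)
    filter_upwards [extChartAt_source_mem_nhds (I := I) x,
      (continuousAt_extChartAt (I := I) x).eventually (Metric.ball_mem_nhds _ hr)] with y hy hy'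
    have := hc _ hy'
    rwa [Function.comp_apply, Function.comp_apply, φ.left_inv hy,
      φ.left_inv (mem_extChartAt_source (I := I) x)] at this
  exact hloc.apply_eq_of_isPreconnected isPreconnected_univ (mem_univ x) (mem_univ y)

/-- An operator depends linearly, hence smoothly, on its values on a finite basis. -/
theorem contMDiffAt_clm_of_apply [FiniteDimensional 𝕜 E] {n : ℕ∞ω}
    {f : G → E →L[𝕜] F} {x : G} (hf : ∀ v, ContMDiffAt I 𝓘(𝕜, F) n (fun g => f g v) x)
    [FiniteDimensional 𝕜 F] :
    ContMDiffAt I 𝓘(𝕜, E →L[𝕜] F) n f x := by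
  let b := Module.finBasis 𝕜 E
  let Φ : (Fin (Module.finrank 𝕜 E) → F) →L[𝕜] (E →L[𝕜] F) :=
    LinearMap.toContinuousLinearMap
      (LinearMap.toContinuousLinearMap.toLinearMap ∘ₗ (b.constr 𝕜).toLinearMap)
  have h : f = Φ ∘ fun g i => f g (b i) := by
    ext g v
    have : (f g : E →ₗ[𝕜] F) = b.constr 𝕜 (fun i => f g (b i)) := by
      refine b.ext fun i => ?_
      rw [b.constr_basis]
      rfl
    exact congrArg (fun l : E →ₗ[𝕜] F => l v) this
  rw [h]
  exact Φ.contMDiff.contMDiffAt.comp x (contMDiffAt_pi_space.2 fun i => hf (b i))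

end

/-! ### Left-invariant connections in the left trivialization: invariance, torsion, Lie bracket. -/

section

variable {𝕜 : Type*} [RCLike 𝕜] {E : Type*} [NormedAddCommGroup E] [NormedSpace 𝕜 E]
  {H : Type*} [TopologicalSpace H] {I : ModelWithCorners 𝕜 E H}
  {G : Type*} [TopologicalSpace G] [ChartedSpace H G] [Group G]

theorem leftDeriv_eq_of_hasMFDerivAt {σ : (g : G) → TangentSpace I g} {g : G} {L : E →L[𝕜] E}
    (h : HasMFDerivAt I 𝓘(𝕜, E) (leftTrivialized σ) g L) : (leftDeriv σ g : E →L[𝕜] E) = L :=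
  h.mfderiv

variable [LieGroup I ∞ G]

theorem hasMFDerivAt_leftTrivialized {σ : (g : G) → TangentSpace I g} {g : G}
    (hσ : MDiffAt (T% σ) g) :
    HasMFDerivAt I 𝓘(𝕜, E) (leftTrivialized σ) g (leftDeriv σ g : E →L[𝕜] E) :=
  (mdifferentiableAt_leftTrivialized hσ).hasMFDerivAt

theorem leftDeriv_mulInvariantVectorField (v : GroupLieAlgebra I G) (g : G) :
    leftDeriv (mulInvariantVectorField v : (g : G) → TangentSpace I g) g = 0 := by
  have h : leftTrivialized (E := E) (mulInvariantVectorField v : (g : G) → TangentSpace I g) =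
      fun _ => v := funext (leftFrom_mulInvariantVectorField v)
  unfold leftDeriv
  rw [h]
  exact mvfderiv_const (F := E) v

theorem mpullback_mul_right_mulInvariantVectorField (a : G) (u : GroupLieAlgebra I G) :
    mpullback I I (fun h => h * a) (mulInvariantVectorField u) =
      mulInvariantVectorField (adjoint I a u) := by
  apply eq_of_leftFrom_eq
  intro g
  rw [leftFrom_mpullback_mul_right, leftFrom_mulInvariantVectorField,
    leftFrom_mulInvariantVectorField]

theorem mlieBracket_mulInvariantVectorField [CompleteSpace E] (u v : GroupLieAlgebra I G) :
    mlieBracket I (mulInvariantVectorField u) (mulInvariantVectorField v) =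
      (mulInvariantVectorField ⁅u, v⁆ : (g : G) → TangentSpace I g) :=
  (mulInvariantVector_mlieBracket u v).symm

variable [FiniteDimensional 𝕜 E]

theorem leftFrom_leftInvariantConnection
    (α : GroupLieAlgebra I G →ₗ[𝕜] GroupLieAlgebra I G →ₗ[𝕜] GroupLieAlgebra I G)
    (X Y : (g : G) → TangentSpace I g) (g : G) :
    leftFrom (I := I) g (covField (leftInvariantConnection α) X Y g) =
      leftDeriv Y g (X g) + α (leftFrom (I := I) g (X g)) (leftFrom (I := I) g (Y g)) :=
  leftFrom_leftTo g _

/-- In the trivialization, pullback is `s ↦ A ∘ s ∘ φ` with `A` independent of the point. Hence `ds`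
transforms correctly by the chain rule and only the compatibility of `α` with `A` matters. Left
translations have `A = id`, right translations have `A = Ad(a)`. -/
theorem isPreservedBy_leftInvariantConnection
    {α : GroupLieAlgebra I G →ₗ[𝕜] GroupLieAlgebra I G →ₗ[𝕜] GroupLieAlgebra I G}
    {φ : G → G} (hφ : MDifferentiable I I φ) (hφ' : ∀ g, (mfderiv I I φ g).IsInvertible)
    (A : GroupLieAlgebra I G →L[𝕜] GroupLieAlgebra I G)
    (hA : ∀ (X : (g : G) → TangentSpace I g) (g : G),
      leftFrom (I := I) g (mpullback I I φ X g) = A (leftFrom (I := I) (φ g) (X (φ g))))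
    (hα : ∀ u v, A (α u v) = α (A u) (A v)) :
    IsPreservedBy (leftInvariantConnection α) φ := by
  intro X Y _ hY
  apply eq_of_leftFrom_eq
  intro g
  have hd : (leftDeriv (mpullback I I φ Y) g : E →L[𝕜] E) =
      (A : E →L[𝕜] E) ∘L (leftDeriv Y (φ g) : E →L[𝕜] E) ∘L (mfderiv I I φ g : E →L[𝕜] E) := by
    apply leftDeriv_eq_of_hasMFDerivAt
    have h : leftTrivialized (E := E) (mpullback I I φ Y) =
        (A : E →L[𝕜] E) ∘ leftTrivialized (E := E) Y ∘ φ := funext (hA Y)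
    rw [h]
    let A' : E →L[𝕜] E := A
    exact A'.hasMFDerivAt.comp g
      ((hasMFDerivAt_leftTrivialized (hY.mdifferentiableAt (φ g))).comp g (hφ g).hasMFDerivAt)
  have hX : (mfderiv I I φ g : E →L[𝕜] E) (mpullback I I φ X g) = X (φ g) := by
    obtain ⟨e, he⟩ := hφ' g
    change mfderiv I I φ g ((mfderiv I I φ g).inverse (X (φ g))) = X (φ g)
    rw [← he, ContinuousLinearMap.inverse_equiv]
    exact e.apply_symm_apply _
  rw [hA, leftFrom_leftInvariantConnection, leftFrom_leftInvariantConnection, hA, hA,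
    ← hα, map_add]
  congr 1
  refine Eq.trans ?_ (congrArg (fun L : E →L[𝕜] E => L (mpullback I I φ X g)) hd).symm
  exact (congrArg (fun w : E => (A : E →L[𝕜] E) ((leftDeriv Y (φ g) : E →L[𝕜] E) w)) hX).symm

theorem isLeftInvariant_leftInvariantConnection
    (α : GroupLieAlgebra I G →ₗ[𝕜] GroupLieAlgebra I G →ₗ[𝕜] GroupLieAlgebra I G) :
    IsLeftInvariant (leftInvariantConnection α) := fun a =>
  isPreservedBy_leftInvariantConnection (mdifferentiableAt_mul_left a)
    (isInvertible_mfderiv_mul_left a) (ContinuousLinearMap.id 𝕜 _)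
    (leftFrom_mpullback_mul_left a) (fun _ _ => rfl)

theorem isPreservedBy_mul_right_iff
    {α : GroupLieAlgebra I G →ₗ[𝕜] GroupLieAlgebra I G →ₗ[𝕜] GroupLieAlgebra I G} {a : G} :
    IsPreservedBy (leftInvariantConnection α) (fun g => g * a) ↔
      ∀ u v, adjoint I a (α u v) = α (adjoint I a u) (adjoint I a v) := by
  refine ⟨fun h u v => ?_, fun h => isPreservedBy_leftInvariantConnection
    (mdifferentiableAt_mul_right a) (isInvertible_mfderiv_mul_right a) (adjoint I a)
    (leftFrom_mpullback_mul_right a) h⟩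
  have h1 := h _ _ (isSmoothField_mulInvariantVectorField u)
    (isSmoothField_mulInvariantVectorField v)
  rw [leftInvariantConnection_apply, mpullback_mul_right_mulInvariantVectorField,
    mpullback_mul_right_mulInvariantVectorField, mpullback_mul_right_mulInvariantVectorField,
    leftInvariantConnection_apply] at h1
  have h2 := congrArg (fun X => leftFrom (I := I) (1 : G) (X 1)) h1
  simpa only [leftFrom_mulInvariantVectorField] using h2

variable [CompleteSpace E]

theorem torsion_leftInvariantConnection_apply
    (α : GroupLieAlgebra I G →ₗ[𝕜] GroupLieAlgebra I G →ₗ[𝕜] GroupLieAlgebra I G)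
    (u v : GroupLieAlgebra I G) (g : G) :
    (leftInvariantConnection α).torsion g (mulInvariantVectorField u g)
      (mulInvariantVectorField v g) = mulInvariantVectorField (α u v - α v u - ⁅u, v⁆) g := by
  rw [CovariantDerivative.torsion_apply _ (mdifferentiableAt_mulInvariantVectorField u)
    (mdifferentiableAt_mulInvariantVectorField v), mlieBracket_mulInvariantVectorField]
  have h1 := congrFun (leftInvariantConnection_apply α u v) g
  have h2 := congrFun (leftInvariantConnection_apply α v u) g
  rw [covField] at h1 h2
  rw [h1, h2]
  change leftTo (I := I) g _ - leftTo (I := I) g _ - leftTo (I := I) g _ = leftTo (I := I) g _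
  rw [map_sub, map_sub]

/-- The torsion of the connection with `α = 0` is computed in two ways: from the definition on `X`
and `Y`, and, by tensoriality, on the left-invariant fields with the same values at `g`. -/
theorem leftFrom_mlieBracket {X Y : (g : G) → TangentSpace I g} {g : G}
    (hX : MDiffAt (T% X) g) (hY : MDiffAt (T% Y) g) :
    leftFrom (I := I) g (mlieBracket I X Y g) =
      leftDeriv Y g (X g) - leftDeriv X g (Y g) +
        ⁅leftFrom (I := I) g (X g), leftFrom (I := I) g (Y g)⁆ := by
  have h := torsion_leftInvariantConnection_apply 0 (leftFrom (I := I) g (X g))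
    (leftFrom (I := I) g (Y g)) g
  have e (X : (g : G) → TangentSpace I g) :
    mulInvariantVectorField (leftFrom (I := I) g (X g)) g = X g := leftTo_leftFrom g (X g)
  rw [e, e, CovariantDerivative.torsion_apply _ hX hY] at h
  have h' := congrArg (leftFrom (I := I) g) h
  rw [map_sub, map_sub] at h'
  have h1 (X Y : (g : G) → TangentSpace I g) :
      leftFrom (I := I) g (leftInvariantConnection 0 Y g (X g)) = leftDeriv Y g (X g) := by
    have := leftFrom_leftInvariantConnection 0 X Y g
    rwa [LinearMap.zero_apply, LinearMap.zero_apply, add_zero] at this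
  rw [LinearMap.zero_apply, LinearMap.zero_apply, LinearMap.zero_apply, LinearMap.zero_apply,
    sub_zero, zero_sub, h1, h1, leftFrom_mulInvariantVectorField, sub_eq_iff_eq_add] at h'
  rw [h']
  abel

end
end LieConnection

/-! ### The derivative of `Ad`; bi-invariance as a derivation property. -/

namespace LieConnection

section

variable {𝕜 : Type*} [RCLike 𝕜] {E : Type*} [NormedAddCommGroup E] [NormedSpace 𝕜 E]
  {H : Type*} [TopologicalSpace H] {I : ModelWithCorners 𝕜 E H}
  {G : Type*} [TopologicalSpace G] [ChartedSpace H G]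

theorem hasMFDerivAt_bilinear (B : E →L[𝕜] E →L[𝕜] E) {f k : G → E} {f' k' : E →L[𝕜] E} {x : G}
    (hf : HasMFDerivAt I 𝓘(𝕜, E) f x f') (hk : HasMFDerivAt I 𝓘(𝕜, E) k x k') :
    HasMFDerivAt I 𝓘(𝕜, E) (fun g => B (f g) (k g)) x
      (B (f x) ∘L k' + B.flip (k x) ∘L f') := by
  have hp : HasMFDerivAt I 𝓘(𝕜, E × E) (fun g : G => (f g, k g)) x (f'.prod k') :=
    ⟨hf.1.prodMk hk.1, hf.2.prodMk hk.2⟩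
  exact (B.isBoundedBilinearMap.hasFDerivAt (f x, k x)).hasMFDerivAt.comp x
    (f := fun g : G => (f g, k g)) hp

variable [Group G] [LieGroup I ∞ G]

variable (I) in
/-- The operator `Ad(g⁻¹)` on the model vector space. -/
noncomputable def adjointInv (g : G) : E →L[𝕜] E := adjoint I g⁻¹

theorem hasMFDerivAt_adjointInv (u : GroupLieAlgebra I G) (g : G) :
    HasMFDerivAt I 𝓘(𝕜, E) (fun g : G => adjointInv I g u) g
      (leftDeriv (rightInvariantField I u) g : E →L[𝕜] E) := by
  have h := hasMFDerivAt_leftTrivialized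
    ((isSmoothField_rightInvariantField (I := I) u).mdifferentiableAt g)
  have e : leftTrivialized (E := E) (rightInvariantField I u) =
      fun g : G => adjointInv I g u := funext (leftFrom_rightInvariantField u)
  rwa [e] at h

variable [FiniteDimensional 𝕜 E]

theorem contMDiff_adjointInv :
    ContMDiff I 𝓘(𝕜, E →L[𝕜] E) ∞ (adjointInv I : G → E →L[𝕜] E) := by
  intro g
  refine contMDiffAt_clm_of_apply fun u => ?_
  have e : leftTrivialized (E := E) (rightInvariantField I u) =
      fun g : G => adjointInv I g u := funext (leftFrom_rightInvariantField u)
  have h := contMDiff_leftTrivialized (isSmoothField_rightInvariantField (I := I) (G := G) u) g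
  rwa [e] at h

variable [CompleteSpace E]

theorem torsion_leftInvariantConnection_eq_zero_iff
    {α : GroupLieAlgebra I G →ₗ[𝕜] GroupLieAlgebra I G →ₗ[𝕜] GroupLieAlgebra I G} :
    (leftInvariantConnection α).torsion = 0 ↔ ∀ u v, α u v - α v u = ⁅u, v⁆ := by
  refine ⟨fun h u v => ?_, fun h => ?_⟩
  · have h1 := torsion_leftInvariantConnection_apply α u v (1 : G)
    rw [h] at h1
    have h2 := congrArg (leftFrom (I := I) (1 : G)) h1
    rw [leftFrom_mulInvariantVectorField] at h2
    exact sub_eq_zero.1 (h2.symm.trans (map_zero _))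
  · ext g X Y
    have h1 := torsion_leftInvariantConnection_apply α (leftFrom (I := I) g X)
      (leftFrom (I := I) g Y) g
    rw [h, sub_self] at h1
    have e (X : TangentSpace I g) : mulInvariantVectorField (leftFrom (I := I) g X) g = X :=
      leftTo_leftFrom g X
    rw [e, e] at h1
    exact h1.trans (map_zero (leftTo (I := I) g))

variable [I.Boundaryless]

/-- The trivialized right-invariant field is `g ↦ Ad(g⁻¹)u`. Its bracket with `w⁺` is zero, and the
bracket formula in the trivialization then gives the derivative. -/
theorem leftDeriv_rightInvariantField (w u : GroupLieAlgebra I G) (g : G) :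
    leftDeriv (rightInvariantField I u) g (leftTo g w) = -⁅w, adjoint I g⁻¹ u⁆ := by
  have h := leftFrom_mlieBracket (g := g) (mdifferentiableAt_mulInvariantVectorField w)
    ((isSmoothField_rightInvariantField (I := I) u).mdifferentiableAt g)
  rw [mlieBracket_mulInvariant_rightInvariant, leftDeriv_mulInvariantVectorField,
    leftFrom_mulInvariantVectorField, leftFrom_rightInvariantField, Pi.zero_apply, map_zero,
    zero_apply, sub_zero] at h
  exact eq_neg_of_add_eq_zero_left h.symm

/-- Equivariance at `g⁻¹` is differentiated at `g = 1` along `w`; both sides pick up the sign from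
`Ad(g⁻¹)`. -/
theorem lie_eq_of_adjoint_equivariant
    {α : GroupLieAlgebra I G →ₗ[𝕜] GroupLieAlgebra I G →ₗ[𝕜] GroupLieAlgebra I G}
    (h : ∀ (a : G) u v, adjoint I a (α u v) = α (adjoint I a u) (adjoint I a v))
    (w u v : GroupLieAlgebra I G) : ⁅w, α u v⁆ = α ⁅w, u⁆ v + α u ⁅w, v⁆ := by
  let B : E →L[𝕜] E →L[𝕜] E := LinearMap.toContinuousBilinearMap (α : E →ₗ[𝕜] E →ₗ[𝕜] E)
  have h1 := hasMFDerivAt_bilinear B (hasMFDerivAt_adjointInv (I := I) u (1 : G))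
    (hasMFDerivAt_adjointInv (I := I) v (1 : G))
  have h2 := hasMFDerivAt_adjointInv (α u v) (1 : G)
  have e : (fun g : G => adjointInv I g (α u v)) =
      fun g : G => B (adjointInv I g u) (adjointInv I g v) :=
    funext fun g => h g⁻¹ u v
  rw [e] at h2
  have h3 := congrArg (fun L : E →L[𝕜] E => L (leftTo (1 : G) w : E)) (hasMFDerivAt_unique h2 h1)
  have h4 : leftDeriv (rightInvariantField I (α u v)) (1 : G) (leftTo (1 : G) w) =
      α (adjoint I (1 : G)⁻¹ u) (leftDeriv (rightInvariantField I v) (1 : G) (leftTo (1 : G) w)) +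
      α (leftDeriv (rightInvariantField I u) (1 : G) (leftTo (1 : G) w)) (adjoint I (1 : G)⁻¹ v) :=
    h3
  simp only [leftDeriv_rightInvariantField, inv_one, adjoint_one, map_neg, LinearMap.neg_apply]
    at h4
  rw [← neg_add, neg_inj] at h4
  rw [h4, add_comm]

theorem adjoint_equivariant_of_lie_eq [PreconnectedSpace G]
    {α : GroupLieAlgebra I G →ₗ[𝕜] GroupLieAlgebra I G →ₗ[𝕜] GroupLieAlgebra I G}
    (h : ∀ w u v : GroupLieAlgebra I G, ⁅w, α u v⁆ = α ⁅w, u⁆ v + α u ⁅w, v⁆) (a : G) (u v : GroupLieAlgebra I G) :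
    adjoint I a (α u v) = α (adjoint I a u) (adjoint I a v) := by
  let B : E →L[𝕜] E →L[𝕜] E := LinearMap.toContinuousBilinearMap (α : E →ₗ[𝕜] E →ₗ[𝕜] E)
  -- `Ad(g⁻¹)` is packaged as a unit of the operator algebra so that its inverse can be
  -- differentiated by the ring-inverse rule.
  let P : G → (E →L[𝕜] E)ˣ := fun g =>
    { val := adjointInv I g
      inv := adjointInv I g⁻¹
      val_inv := by
        ext x
        refine ((adjoint_mul (I := I) g⁻¹ g⁻¹⁻¹ x).symm.trans ?_)
        rw [mul_inv_cancel]
        exact adjoint_one x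
      inv_val := by
        ext x
        refine ((adjoint_mul (I := I) g⁻¹⁻¹ g⁻¹ x).symm.trans ?_)
        rw [inv_mul_cancel]
        exact adjoint_one x }
  -- This is `Ad(g) α(Ad(g⁻¹)u, Ad(g⁻¹)v)`. Its value at `1` is `α(u, v)`, and comparison with its
  -- value at `a⁻¹` gives equivariance under `Ad(a)`.
  let c : G → E := fun g => Ring.inverse (P g : E →L[𝕜] E) (B ((P g : E →L[𝕜] E) u)
    ((P g : E →L[𝕜] E) v))
  have hP (g : G) : MDifferentiableAt I 𝓘(𝕜, E →L[𝕜] E) (fun g => (P g : E →L[𝕜] E)) g :=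
    contMDiff_adjointInv.mdifferentiable (by simp) g
  let DP (g : G) : E →L[𝕜] E →L[𝕜] E :=
    mfderiv I 𝓘(𝕜, E →L[𝕜] E) (fun g => (P g : E →L[𝕜] E)) g
  let adE (w : GroupLieAlgebra I G) : E →L[𝕜] E :=
    LinearMap.toContinuousLinearMap (LieAlgebra.ad 𝕜 (GroupLieAlgebra I G) w : E →ₗ[𝕜] E)
  have hP' (g : G) (w : GroupLieAlgebra I G) :
      DP g (leftTo g w : E) = -adE w * (P g : E →L[𝕜] E) := by
    ext x
    have h1 := (ContinuousLinearMap.apply 𝕜 E x).hasMFDerivAt.comp g (hP g).hasMFDerivAt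
    have h2 := hasMFDerivAt_unique h1 (hasMFDerivAt_adjointInv (I := I) x g)
    exact (congrArg (fun L : E →L[𝕜] E => L (leftTo g w : E)) h2).trans
      (leftDeriv_rightInvariantField w x g)
  have hc (g : G) : HasMFDerivAt I 𝓘(𝕜, E) c g (0 : E →L[𝕜] E) := by
    obtain ⟨Ψ', h1, h2⟩ := exists_hasFDerivAt_conj_bilinear B (P g) u v
    have h3 : HasMFDerivAt I 𝓘(𝕜, E) c g (Ψ' ∘L DP g) :=
      h1.hasMFDerivAt.comp g (hP g).hasMFDerivAt
    have h4 : Ψ' ∘L DP g = 0 := by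
      ext ξ
      have hξ : (leftTo (I := I) g (leftFrom (I := I) g ξ) : E) = ξ := leftTo_leftFrom g ξ
      -- Every tangent direction is `leftTo g w`, along which `P` moves by `-ad w` times `P`; since
      -- `-ad w` is a derivation of `α`, the derivative of the conjugated product vanishes.
      rw [ContinuousLinearMap.comp_apply, ← hξ, hP']
      refine h2 _ fun x y => ?_
      have h5 (w x y : GroupLieAlgebra I G) : -⁅w, α x y⁆ = α (-⁅w, x⁆) y + α x (-⁅w, y⁆) := by
        rw [h, map_neg, map_neg, LinearMap.neg_apply, neg_add]
      exact h5 _ x y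
    exact h3.congr_mfderiv h4
  have hcc := eq_of_mfderiv_eq_zero (fun g => (hc g).mdifferentiableAt) (fun g => (hc g).mfderiv)
    a⁻¹ 1
  have hcv (g : G) : c g = adjoint I g⁻¹⁻¹ (α (adjoint I g⁻¹ u) (adjoint I g⁻¹ v)) :=
    congrArg (fun L : E →L[𝕜] E => L _) (Ring.inverse_unit (P g))
  rw [hcv, hcv] at hcc
  have h6 : adjoint I a⁻¹⁻¹⁻¹ (α (adjoint I a⁻¹⁻¹ u) (adjoint I a⁻¹⁻¹ v)) =
    adjoint I (1 : G)⁻¹⁻¹ (α (adjoint I (1 : G)⁻¹ u) (adjoint I (1 : G)⁻¹ v)) := hcc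
  simp only [inv_inv, inv_one, adjoint_one] at h6
  rw [← h6, ← adjoint_mul, mul_inv_cancel, adjoint_one]

theorem isBiInvariant_leftInvariantConnection_iff [PreconnectedSpace G]
    {α : GroupLieAlgebra I G →ₗ[𝕜] GroupLieAlgebra I G →ₗ[𝕜] GroupLieAlgebra I G} :
    IsBiInvariant (leftInvariantConnection α) ↔
      ∀ w u v : GroupLieAlgebra I G, ⁅w, α u v⁆ = α ⁅w, u⁆ v + α u ⁅w, v⁆ :=
  ⟨fun h => lie_eq_of_adjoint_equivariant fun a => isPreservedBy_mul_right_iff.1 (h.2 a),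
    fun h => ⟨isLeftInvariant_leftInvariantConnection α, fun a =>
      isPreservedBy_mul_right_iff.2 (adjoint_equivariant_of_lie_eq h a)⟩⟩

end
end LieConnection

/-! ### Smoothness and curvature of left-invariant connections. -/

namespace LieConnection

section

variable {𝕜 : Type*} [RCLike 𝕜] {E : Type*} [NormedAddCommGroup E] [NormedSpace 𝕜 E]
  {H : Type*} [TopologicalSpace H] {I : ModelWithCorners 𝕜 E H}
  {G : Type*} [TopologicalSpace G] [ChartedSpace H G] [Group G] [LieGroup I ∞ G]

theorem contMDiff_leftDeriv_apply {σ X : (g : G) → TangentSpace I g} (hσ : IsSmoothField σ)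
    (hX : IsSmoothField X) :
    ContMDiff I 𝓘(𝕜, E) (M' := E) ∞ (fun g => leftDeriv σ g (X g)) := by
  have h1 : ContMDiff I.tangent 𝓘(𝕜, E).tangent ∞
      (tangentMap I 𝓘(𝕜, E) (leftTrivialized (E := E) σ)) :=
    ContMDiff.contMDiff_tangentMap (n := ∞) (m := ∞) (contMDiff_leftTrivialized hσ) (by simp)
  exact (contMDiff_snd_tangentBundle_modelSpace E 𝓘(𝕜, E)).comp (h1.comp hX)

variable (I) in
/-- Left translation to `g` read in the trivialization of the tangent bundle at `x`. -/
noncomputable def leftToCoord (x g : G) : E →L[𝕜] E :=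
  (trivializationAt E (TangentSpace I : G → Type _) x).continuousLinearMapAt 𝕜 g ∘L leftTo g

variable (I) in
/-- The inverse of `leftToCoord x g` for `g` close to `x`. -/
noncomputable def leftFromCoord (x g : G) : E →L[𝕜] E :=
  leftFrom g ∘L (trivializationAt E (TangentSpace I : G → Type _) x).symmL 𝕜 g

theorem leftToCoord_comp_leftFromCoord {x g : G}
    (hg : g ∈ (trivializationAt E (TangentSpace I : G → Type _) x).baseSet) :
    leftToCoord I x g * leftFromCoord I x g = 1 := by
  ext v
  refine (congrArg ((trivializationAt E (TangentSpace I : G → Type _) x).continuousLinearMapAt 𝕜 g)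
    (leftTo_leftFrom g _)).trans ?_
  exact (trivializationAt E (TangentSpace I : G → Type _) x).continuousLinearMapAt_symmL hg v

theorem leftFromCoord_comp_leftToCoord {x g : G}
    (hg : g ∈ (trivializationAt E (TangentSpace I : G → Type _) x).baseSet) :
    leftFromCoord I x g * leftToCoord I x g = 1 := by
  ext v
  refine (congrArg (leftFrom (I := I) g) ((trivializationAt E (TangentSpace I : G → Type _)
    x).symmL_continuousLinearMapAt hg _)).trans ?_
  exact leftFrom_leftTo g v

theorem isSmoothField_covField
    {nabla : CovariantDerivative I E (TangentSpace I : G → Type _)}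
    (h : nabla.ContMDiffCovariantDerivative ∞) {X Y : (g : G) → TangentSpace I g}
    (hX : IsSmoothField X) (hY : IsSmoothField Y) : IsSmoothField (covField nabla X Y) := by
  have h1 := contMDiffOn_univ.1 (h.contMDiff.contMDiff (σ := Y) (contMDiffOn_univ.2 hY))
  exact ContMDiff.clm_bundle_apply h1 hX

variable [FiniteDimensional 𝕜 E]

theorem contMDiffAt_leftToCoord (x : G) :
    ContMDiffAt I 𝓘(𝕜, E →L[𝕜] E) ∞ (leftToCoord I x) x := by
  refine contMDiffAt_clm_of_apply fun v => ?_
  have h := (contMDiffAt_totalSpace.1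
    (isSmoothField_mulInvariantVectorField (I := I) (G := G) v x)).2
  refine h.congr_of_eventuallyEq ?_
  have hb := (trivializationAt E (TangentSpace I : G → Type _) x).open_baseSet.mem_nhds
    (FiberBundle.mem_baseSet_trivializationAt E (TangentSpace I : G → Type _) x)
  filter_upwards [hb] with g hg
  exact congrFun (Trivialization.coe_linearMapAt_of_mem (R := 𝕜)
    (trivializationAt E (TangentSpace I : G → Type _) x) hg) (mulInvariantVectorField v g)

/-- Near `x` this is the ring inverse of `leftToCoord`, and inversion is smooth at units. -/
theorem contMDiffAt_leftFromCoord [CompleteSpace E] (x : G) :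
    ContMDiffAt I 𝓘(𝕜, E →L[𝕜] E) ∞ (leftFromCoord I x) x := by
  have hx := FiberBundle.mem_baseSet_trivializationAt E (TangentSpace I : G → Type _) x
  have hb := (trivializationAt E (TangentSpace I : G → Type _) x).open_baseSet.mem_nhds hx
  let U (g : G) (hg : g ∈ (trivializationAt E (TangentSpace I : G → Type _) x).baseSet) :
      (E →L[𝕜] E)ˣ :=
    ⟨leftToCoord I x g, leftFromCoord I x g, leftToCoord_comp_leftFromCoord hg,
      leftFromCoord_comp_leftToCoord hg⟩
  have h := (contDiffAt_ringInverse 𝕜 (n := ∞) (U x hx)).contMDiffAt.comp x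
    (f := leftToCoord I x) (contMDiffAt_leftToCoord (I := I) x)
  refine h.congr_of_eventuallyEq ?_
  filter_upwards [hb] with g hg
  exact (Ring.inverse_unit (U g hg)).symm

variable [CompleteSpace E]

theorem contMDiffCovariantDerivative_leftInvariantConnection
    (α : GroupLieAlgebra I G →ₗ[𝕜] GroupLieAlgebra I G →ₗ[𝕜] GroupLieAlgebra I G) :
    (leftInvariantConnection α).ContMDiffCovariantDerivative ∞ := by
  refine ⟨⟨fun {σ} hσ => ?_⟩⟩
  have hσ' : IsSmoothField σ := by
    have := contMDiffOn_univ.1 hσ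
    exact this
  -- The endomorphism `∇σ` in the left frame; in the bundle trivialization it becomes `leftToCoord ∘
  -- A ∘ leftFromCoord`.
  let A (g : G) : E →L[𝕜] E := (leftDeriv σ g : E →L[𝕜] E) ∘L (leftTo (I := I) g : E →L[𝕜] E) +
    (α.flip (leftFrom g (σ g))).toContinuousLinearMap
  have hA : ContMDiff I 𝓘(𝕜, E →L[𝕜] E) ∞ A := by
    intro x
    refine contMDiffAt_clm_of_apply fun v => ?_
    have h1 := contMDiff_leftDeriv_apply hσ' (isSmoothField_mulInvariantVectorField v)
    let αv : E →L[𝕜] E := LinearMap.toContinuousLinearMap (α v : E →ₗ[𝕜] E)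
    have h2 := αv.contMDiff.comp (contMDiff_leftTrivialized hσ')
    exact (h1.add h2) x
  refine contMDiffOn_univ.2 fun x => ?_
  rw [contMDiffAt_hom_bundle]
  refine ⟨contMDiffAt_id, ?_⟩
  have h := (contMDiffAt_leftToCoord (I := I) x).clm_comp
    ((hA x).clm_comp (contMDiffAt_leftFromCoord (I := I) x))
  refine h.congr_of_eventuallyEq (Filter.Eventually.of_forall fun g => ?_)
  ext v
  have e : ∀ ξ : TangentSpace I g, leftTo g (leftFrom (I := I) g ξ) = ξ := leftTo_leftFrom g
  have e2 (ξ : TangentSpace I g) : (leftDeriv σ g : TangentSpace I g →L[𝕜] GroupLieAlgebra I G) ξ =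
      leftDeriv σ g (leftTo g (leftFrom (I := I) g ξ)) := by rw [e]
  exact congrArg (fun w : GroupLieAlgebra I G =>
    (trivializationAt E (TangentSpace I : G → Type _) x).continuousLinearMapAt 𝕜 g
      (leftTo g (w + (α.flip (leftFrom g (σ g))) (leftFrom (I := I) g
      ((trivializationAt E (TangentSpace I : G → Type _) x).symmL 𝕜 g v)))))
    (e2 _)

/-- The curvature of the left-invariant connection with product `α`, on the Lie algebra. -/
noncomputable def lieCurvature (α : GroupLieAlgebra I G →ₗ[𝕜] GroupLieAlgebra I G →ₗ[𝕜] GroupLieAlgebra I G)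
    (u v w : GroupLieAlgebra I G) : GroupLieAlgebra I G :=
  α u (α v w) - α v (α u w) - α ⁅u, v⁆ w

/-- In the trivialization `∇_Y Z` is its value for `α = 0` plus `α(Y, Z)`, and the product rule
handles the latter. The second-order part is thus isolated in a term that does not involve `α`. -/
theorem leftDeriv_covField
    (α : GroupLieAlgebra I G →ₗ[𝕜] GroupLieAlgebra I G →ₗ[𝕜] GroupLieAlgebra I G)
    {Y Z : (g : G) → TangentSpace I g} (hY : IsSmoothField Y) (hZ : IsSmoothField Z) (g : G)
    (ξ : TangentSpace I g) :
    leftDeriv (covField (leftInvariantConnection α) Y Z) g ξ =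
      leftDeriv (covField (leftInvariantConnection 0) Y Z) g ξ +
        (α (leftFrom g (Y g)) (leftDeriv Z g ξ) + α (leftDeriv Y g ξ) (leftFrom g (Z g))) := by
  let B : E →L[𝕜] E →L[𝕜] E := LinearMap.toContinuousBilinearMap (α : E →ₗ[𝕜] E →ₗ[𝕜] E)
  have h0 := hasMFDerivAt_leftTrivialized ((isSmoothField_covField
    (contMDiffCovariantDerivative_leftInvariantConnection (0 : GroupLieAlgebra I G →ₗ[𝕜]
      GroupLieAlgebra I G →ₗ[𝕜] GroupLieAlgebra I G)) hY hZ).mdifferentiableAt g)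
  have h1 := hasMFDerivAt_bilinear B (hasMFDerivAt_leftTrivialized (hY.mdifferentiableAt g))
    (hasMFDerivAt_leftTrivialized (hZ.mdifferentiableAt g))
  have h2 := h0.add h1
  have e : leftTrivialized (E := E) (covField (leftInvariantConnection α) Y Z) =
      leftTrivialized (E := E) (covField (leftInvariantConnection 0) Y Z) +
        fun g => B (leftTrivialized (E := E) Y g) (leftTrivialized (E := E) Z g) := by
    funext g
    have h3 := leftFrom_leftInvariantConnection α Y Z g
    have h4 := leftFrom_leftInvariantConnection 0 Y Z g
    rw [LinearMap.zero_apply, LinearMap.zero_apply, add_zero] at h4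
    rw [← h4] at h3
    exact h3
  rw [← e] at h2
  exact congrArg (fun L : E →L[𝕜] E => L ξ) (leftDeriv_eq_of_hasMFDerivAt h2)

/-- Terms in which `α` meets a derivative of `X`, `Y` or `Z` cancel, using the bracket formula. The
curvature for `α = 0` need not be computed, because it drops out when two connections are compared.
-/
theorem leftFrom_curvatureField
    (α : GroupLieAlgebra I G →ₗ[𝕜] GroupLieAlgebra I G →ₗ[𝕜] GroupLieAlgebra I G)
    {X Y Z : (g : G) → TangentSpace I g} (hX : IsSmoothField X) (hY : IsSmoothField Y)
    (hZ : IsSmoothField Z) (g : G) :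
    leftFrom (I := I) g (curvatureField (leftInvariantConnection α) X Y Z g) =
      leftFrom (I := I) g (curvatureField (leftInvariantConnection 0) X Y Z g) +
        lieCurvature α (leftFrom g (X g)) (leftFrom g (Y g)) (leftFrom g (Z g)) := by
  have hsub (β : GroupLieAlgebra I G →ₗ[𝕜] GroupLieAlgebra I G →ₗ[𝕜] GroupLieAlgebra I G) :
      leftFrom (I := I) g (curvatureField (leftInvariantConnection β) X Y Z g) =
        leftFrom (I := I) g (covField (leftInvariantConnection β) X
          (covField (leftInvariantConnection β) Y Z) g) -
        leftFrom (I := I) g (covField (leftInvariantConnection β) Y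
          (covField (leftInvariantConnection β) X Z) g) -
        leftFrom (I := I) g (covField (leftInvariantConnection β) (mlieBracket I X Y) Z g) := by
    simp only [curvatureField, Pi.sub_apply, map_sub]
  rw [hsub, hsub]
  rw [leftFrom_leftInvariantConnection α X, leftFrom_leftInvariantConnection α Y,
    leftFrom_leftInvariantConnection α (mlieBracket I X Y),
    leftFrom_leftInvariantConnection α Y, leftFrom_leftInvariantConnection α X,
    leftFrom_leftInvariantConnection 0 X, leftFrom_leftInvariantConnection 0 Y,
    leftFrom_leftInvariantConnection 0 (mlieBracket I X Y),
    leftFrom_leftInvariantConnection 0 Y, leftFrom_leftInvariantConnection 0 X]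
  rw [leftDeriv_covField α hY hZ, leftDeriv_covField α hX hZ,
    leftFrom_mlieBracket (hX.mdifferentiableAt g) (hY.mdifferentiableAt g), lieCurvature]
  simp only [map_add, map_sub, LinearMap.add_apply, LinearMap.sub_apply, LinearMap.zero_apply]
  abel

theorem sameCurvature_leftInvariantConnection_iff
    {α β : GroupLieAlgebra I G →ₗ[𝕜] GroupLieAlgebra I G →ₗ[𝕜] GroupLieAlgebra I G} :
    SameCurvature (leftInvariantConnection α) (leftInvariantConnection β) ↔
      ∀ u v w, lieCurvature α u v w = lieCurvature β u v w := by
  refine ⟨fun h u v w => ?_, fun h X Y Z hX hY hZ => ?_⟩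
  · have hu := isSmoothField_mulInvariantVectorField (I := I) (G := G) u
    have hv := isSmoothField_mulInvariantVectorField (I := I) (G := G) v
    have hw := isSmoothField_mulInvariantVectorField (I := I) (G := G) w
    have h1 : leftFrom (I := I) (1 : G) _ = leftFrom (I := I) (1 : G) _ :=
      congrArg (fun X => leftFrom (I := I) (1 : G) (X 1)) (h _ _ _ hu hv hw)
    rw [leftFrom_curvatureField α hu hv hw, leftFrom_curvatureField β hu hv hw,
      leftFrom_mulInvariantVectorField, leftFrom_mulInvariantVectorField,
      leftFrom_mulInvariantVectorField] at h1
    exact add_left_cancel h1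
  · apply eq_of_leftFrom_eq
    intro g
    rw [leftFrom_curvatureField α hX hY hZ, leftFrom_curvatureField β hX hY hZ, h]

end
end LieConnection

/-! ### The algebra: commutativity, derivations and associativity for `½[ , ] + μ`. -/

section

variable {K L : Type*} [Field K] [LieRing L] [LieAlgebra K L]
  {α half μ : L →ₗ[K] L →ₗ[K] L}

theorem antisymmetrization_eq_lie_iff [CharZero K]
    (hh : ∀ u v, half u v = (1 / 2 : K) • ⁅u, v⁆) :
    (∀ u v, (half + μ) u v - (half + μ) v u = ⁅u, v⁆) ↔ ∀ u v, μ u v = μ v u := by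
  refine forall₂_congr fun u v => ?_
  have h : (half + μ) u v - (half + μ) v u = ⁅u, v⁆ + (μ u v - μ v u) := by
    simp only [LinearMap.add_apply, hh, ← lie_skew u v]
    module
  rw [h, add_eq_left, sub_eq_zero]

/-- The `half` part satisfies the identity by Jacobi and cancels from both sides. -/
theorem lie_derivation_iff (hh : ∀ u v, half u v = (1 / 2 : K) • ⁅u, v⁆) :
    (∀ w u v : L, ⁅w, (half + μ) u v⁆ = (half + μ) ⁅w, u⁆ v + (half + μ) u ⁅w, v⁆) ↔
      ∀ w u v : L, ⁅w, μ u v⁆ = μ ⁅w, u⁆ v + μ u ⁅w, v⁆ := by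
  refine forall_congr' fun w => forall₂_congr fun u v => ?_
  simp only [LinearMap.add_apply, hh, lie_add, lie_smul]
  rw [leibniz_lie w u v, smul_add, add_add_add_comm, add_right_inj]

theorem isPoissonProduct_iff_curvature [CharZero K]
    (hh : ∀ u v, half u v = (1 / 2 : K) • ⁅u, v⁆)
    (hc : ∀ u v, μ u v = μ v u) (hl : ∀ w u v : L, ⁅w, μ u v⁆ = μ ⁅w, u⁆ v + μ u ⁅w, v⁆) :
    (∀ u v w, (half + μ) u ((half + μ) v w) - (half + μ) v ((half + μ) u w) -
        (half + μ) ⁅u, v⁆ w = half u (half v w) - half v (half u w) - half ⁅u, v⁆ w) ↔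
      IsPoissonProduct μ := by
  -- The Leibniz rule expands the mixed terms to `½(μ [u,v] w - μ [v,u] w) = μ [u,v] w`, which `-μ
  -- [u,v] w` cancels; only the commutator of multiplications remains.
  have h (u v w : L) : (half + μ) u ((half + μ) v w) - (half + μ) v ((half + μ) u w) -
      (half + μ) ⁅u, v⁆ w = half u (half v w) - half v (half u w) - half ⁅u, v⁆ w +
        (μ u (μ v w) - μ v (μ u w)) := by
    have e : μ ⁅v, u⁆ w = -μ ⁅u, v⁆ w := by
      rw [← lie_skew v u, map_neg, LinearMap.neg_apply]
    simp only [LinearMap.add_apply, hh, map_add, lie_smul, map_smul, hl, e]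
    module
  simp only [h, add_eq_left, sub_eq_zero]
  refine ⟨fun h1 => ⟨hc, fun u v w => ?_, hl⟩, fun h1 u v w => ?_⟩
  -- `(uv)w = w(uv) = u(wv) = u(vw)`.
  · rw [hc (μ u v) w, h1 w u v, hc w v]
  · rw [← h1.assoc, h1.comm u v, h1.assoc]

end

/-! ### Reduction of a left-invariant connection to its product, and the bijection. -/

namespace LieConnection

section

variable {𝕜 : Type*} [RCLike 𝕜] {E : Type*} [NormedAddCommGroup E] [NormedSpace 𝕜 E]
  {H : Type*} [TopologicalSpace H] {I : ModelWithCorners 𝕜 E H}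
  {G : Type*} [TopologicalSpace G] [ChartedSpace H G] [Group G] [LieGroup I ∞ G]

theorem IsPreservedBy.congr {nabla nabla' : CovariantDerivative I E (TangentSpace I : G → Type _)}
    (h : SameConnection nabla nabla') {φ : G → G}
    (hφ : ∀ X : (g : G) → TangentSpace I g, IsSmoothField X → IsSmoothField (mpullback I I φ X))
    (hn : IsPreservedBy nabla φ) : IsPreservedBy nabla' φ := by
  intro X Y hX hY
  have h1 := hn X Y hX hY
  have e1 : covField nabla X Y = covField nabla' X Y :=
    funext fun g => by rw [covField, covField, h Y hY]
  have e2 : covField nabla (mpullback I I φ X) (mpullback I I φ Y) =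
      covField nabla' (mpullback I I φ X) (mpullback I I φ Y) :=
    funext fun g => by rw [covField, covField, h _ (hφ Y hY)]
  rw [e1, e2] at h1
  exact h1

theorem IsBiInvariant.congr {nabla nabla' : CovariantDerivative I E (TangentSpace I : G → Type _)}
    (h : SameConnection nabla nabla') (hn : IsBiInvariant nabla) : IsBiInvariant nabla' :=
  ⟨fun a => (hn.1 a).congr h fun _ hX => isSmoothField_mpullback_mul_left a hX,
    fun a => (hn.2 a).congr h fun _ hX => isSmoothField_mpullback_mul_right a hX⟩

/-- Agreement is known only on smooth fields, so the inner field `∇_Y Z` must be smooth before the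
outer derivatives can be compared. -/
theorem curvatureField_congr
    {nabla nabla' : CovariantDerivative I E (TangentSpace I : G → Type _)}
    (h : SameConnection nabla nabla') (hn : nabla.ContMDiffCovariantDerivative ∞)
    {X Y Z : (g : G) → TangentSpace I g} (hX : IsSmoothField X) (hY : IsSmoothField Y)
    (hZ : IsSmoothField Z) : curvatureField nabla X Y Z = curvatureField nabla' X Y Z := by
  have h1 (X : (g : G) → TangentSpace I g) : covField nabla X Z = covField nabla' X Z := by
    funext g
    rw [covField, covField, h Z hZ]
  have h2 {X Y : (g : G) → TangentSpace I g} (hY : IsSmoothField Y) :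
      covField nabla X (covField nabla Y Z) = covField nabla' X (covField nabla' Y Z) := by
    rw [← h1]
    funext g
    rw [covField, covField, h _ (isSmoothField_covField hn hY hZ)]
  rw [curvatureField, curvatureField, h2 hY, h2 hX, h1]

/-- `∇_{u⁺} v⁺` is preserved by left translations because `u⁺`, `v⁺` and `∇` are, so it is
determined by its value at `1`. -/
theorem covField_of_isLeftInvariant
    {nabla : CovariantDerivative I E (TangentSpace I : G → Type _)} (h : IsLeftInvariant nabla)
    (u v : GroupLieAlgebra I G) :
    covField nabla (mulInvariantVectorField u) (mulInvariantVectorField v) =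
      mulInvariantVectorField (alphaOf nabla u v) := by
  funext g
  have h1 := mulInvariantVectorField_eq_mpullback g
    (covField nabla (mulInvariantVectorField u) (mulInvariantVectorField v))
  rw [h g⁻¹ _ _ (isSmoothField_mulInvariantVectorField u)
    (isSmoothField_mulInvariantVectorField v), mpullback_mulInvariantVectorField,
    mpullback_mulInvariantVectorField] at h1
  exact h1.symm

theorem alphaOf_eq {nabla : CovariantDerivative I E (TangentSpace I : G → Type _)}
    {α : GroupLieAlgebra I G →ₗ[𝕜] GroupLieAlgebra I G →ₗ[𝕜] GroupLieAlgebra I G}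
    (h : ∀ u v, covField nabla (mulInvariantVectorField u) (mulInvariantVectorField v) =
      mulInvariantVectorField (α u v)) : alphaOf nabla = α := by
  ext u v
  exact (congrFun (h u v) 1).trans (mulInvariantVectorField_one (α u v))

section

variable [CompleteSpace E]

theorem halfBracket_apply (u v : GroupLieAlgebra I G) :
    halfBracket u v = (1 / 2 : 𝕜) • ⁅u, v⁆ := rfl

theorem halfBracket_add_productOf
    (nabla : CovariantDerivative I E (TangentSpace I : G → Type _)) :
    halfBracket + productOf nabla = alphaOf nabla :=
  add_sub_cancel _ _

theorem productOf_congr {nabla nabla' : CovariantDerivative I E (TangentSpace I : G → Type _)}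
    (h : SameConnection nabla nabla') : productOf nabla = productOf nabla' := by
  rw [productOf, productOf]
  congr 1
  ext u v
  exact congrArg (fun L => L 1 (mulInvariantVectorField u (1 : G)))
    (h _ (isSmoothField_mulInvariantVectorField v))

theorem half_smul_mlieBracket_add
    (mul : GroupLieAlgebra I G →ₗ[𝕜] GroupLieAlgebra I G →ₗ[𝕜] GroupLieAlgebra I G)
    (u v : GroupLieAlgebra I G) :
    (1 / 2 : 𝕜) • mlieBracket I (mulInvariantVectorField u) (mulInvariantVectorField v) +
        mulInvariantVectorField (mul u v) =
      (mulInvariantVectorField (((halfBracket :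
        GroupLieAlgebra I G →ₗ[𝕜] GroupLieAlgebra I G →ₗ[𝕜] GroupLieAlgebra I G) + mul) u v) : (g : G) → TangentSpace I g) := by
  rw [LinearMap.add_apply, LinearMap.add_apply, halfBracket_apply, mulInvariantVectorField_add,
    mulInvariantVectorField_smul, mlieBracket_mulInvariantVectorField]

end

variable [FiniteDimensional 𝕜 E]

/-- The difference of two connections at `g` depends only on `σ g`, so `σ` may be replaced by the
left-invariant field with that value. -/
theorem eq_of_eq_mulInvariantVectorField
    {nabla nabla' : CovariantDerivative I E (TangentSpace I : G → Type _)}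
    (h : ∀ v : GroupLieAlgebra I G,
      nabla (mulInvariantVectorField v) = nabla' (mulInvariantVectorField v))
    {σ : (g : G) → TangentSpace I g} {g : G} (hσ : MDiffAt (T% σ) g) :
    nabla σ g = nabla' σ g := by
  have h1 := IsCovariantDerivativeOn.difference_apply nabla.isCovariantDerivativeOnUniv
    nabla'.isCovariantDerivativeOnUniv (x := g) (hx := trivial) hσ
  have h2 := IsCovariantDerivativeOn.difference_apply nabla.isCovariantDerivativeOnUniv
    nabla'.isCovariantDerivativeOnUniv (x := g) (hx := trivial)
    (mdifferentiableAt_mulInvariantVectorField (leftFrom (I := I) g (σ g)))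
  rw [h, sub_self] at h2
  have e : mulInvariantVectorField (leftFrom (I := I) g (σ g)) g = σ g := leftTo_leftFrom g (σ g)
  rw [e] at h2
  exact sub_eq_zero.1 (h1.symm.trans h2)

theorem eq_leftInvariantConnection
    {nabla : CovariantDerivative I E (TangentSpace I : G → Type _)}
    {α : GroupLieAlgebra I G →ₗ[𝕜] GroupLieAlgebra I G →ₗ[𝕜] GroupLieAlgebra I G}
    (h : ∀ u v, covField nabla (mulInvariantVectorField u) (mulInvariantVectorField v) =
      mulInvariantVectorField (α u v))
    {σ : (g : G) → TangentSpace I g} {g : G} (hσ : MDiffAt (T% σ) g) :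
    nabla σ g = leftInvariantConnection α σ g := by
  refine eq_of_eq_mulInvariantVectorField (fun v => ?_) hσ
  funext g
  ext ξ
  have h1 := congrFun ((h (leftFrom g ξ) v).trans
    (leftInvariantConnection_apply α (leftFrom g ξ) v).symm) g
  have e : mulInvariantVectorField (leftFrom (I := I) g ξ) g = ξ := leftTo_leftFrom g ξ
  rw [covField, covField, e] at h1
  exact h1

theorem sameConnection_of_isLeftInvariant
    {nabla : CovariantDerivative I E (TangentSpace I : G → Type _)} (h : IsLeftInvariant nabla) :
    SameConnection nabla (leftInvariantConnection (alphaOf nabla)) := fun _ hY =>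
  funext fun g => eq_leftInvariantConnection (covField_of_isLeftInvariant h)
    (hY.mdifferentiableAt g)

variable [CompleteSpace E]

/-- Torsion is evaluated on local extensions of tangent vectors that are used only as differentiable
at the point. Hence the hypothesis asks for agreement on such fields, which is more than
`SameConnection`. -/
theorem torsion_congr {nabla nabla' : CovariantDerivative I E (TangentSpace I : G → Type _)}
    (h : ∀ {σ : (g : G) → TangentSpace I g} {g : G}, MDiffAt (T% σ) g → nabla σ g = nabla' σ g) :
    nabla.torsion = nabla'.torsion := by
  ext g X Y
  rw [CovariantDerivative.torsion_apply_eq_extend, CovariantDerivative.torsion_apply_eq_extend,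
    h (FiberBundle.mdifferentiableAt_extend ..),
    h (FiberBundle.mdifferentiableAt_extend ..)]

theorem productOf_connectionOf
    (mul : GroupLieAlgebra I G →ₗ[𝕜] GroupLieAlgebra I G →ₗ[𝕜] GroupLieAlgebra I G) :
    productOf (connectionOf mul) = mul := by
  rw [productOf, connectionOf, alphaOf_eq (leftInvariantConnection_apply _), add_sub_cancel_left]

theorem sameConnection_connectionOf_productOf
    {nabla : CovariantDerivative I E (TangentSpace I : G → Type _)} (h : IsLeftInvariant nabla) :
    SameConnection nabla (connectionOf (productOf nabla)) := by
  rw [connectionOf, halfBracket_add_productOf]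
  exact sameConnection_of_isLeftInvariant h

variable [I.Boundaryless] [PreconnectedSpace G]

theorem isPoissonProduct_iff
    {mul : GroupLieAlgebra I G →ₗ[𝕜] GroupLieAlgebra I G →ₗ[𝕜] GroupLieAlgebra I G} :
    IsPoissonProduct mul ↔ (connectionOf mul).torsion = 0 ∧ IsBiInvariant (connectionOf mul) ∧
      SameCurvature (connectionOf mul) nablaZero := by
  have hh : ∀ u v : GroupLieAlgebra I G, halfBracket u v = (1 / 2 : 𝕜) • ⁅u, v⁆ :=
    halfBracket_apply
  have h1 := (torsion_leftInvariantConnection_eq_zero_iff (α := halfBracket + mul)).trans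
    (antisymmetrization_eq_lie_iff (K := 𝕜) (L := GroupLieAlgebra I G) hh)
  have h2 := (isBiInvariant_leftInvariantConnection_iff (α := halfBracket + mul)).trans
    (lie_derivation_iff (K := 𝕜) (L := GroupLieAlgebra I G) hh)
  have h3 := sameCurvature_leftInvariantConnection_iff (α := halfBracket + mul) (β := halfBracket)
  have h4 (hc : ∀ u v, mul u v = mul v u)
      (hl : ∀ w u v : GroupLieAlgebra I G, ⁅w, mul u v⁆ = mul ⁅w, u⁆ v + mul u ⁅w, v⁆) :=
    h3.trans (isPoissonProduct_iff_curvature (K := 𝕜) (L := GroupLieAlgebra I G) hh hc hl)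
  exact ⟨fun h => ⟨h1.2 h.comm, h2.2 h.leibniz, (h4 h.comm h.leibniz).2 h⟩,
    fun h => (h4 (h1.1 h.1) (h2.1 h.2.1)).1 h.2.2⟩

theorem isPoissonProduct_productOf_iff
    {nabla : CovariantDerivative I E (TangentSpace I : G → Type _)}
    (hn : nabla.ContMDiffCovariantDerivative ∞) (h : IsLeftInvariant nabla) :
    IsPoissonProduct (productOf nabla) ↔
      nabla.torsion = 0 ∧ IsBiInvariant nabla ∧ SameCurvature nabla nablaZero := by
  have hs := sameConnection_connectionOf_productOf h
  have ht : nabla.torsion = (connectionOf (productOf nabla)).torsion := by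
    rw [connectionOf, halfBracket_add_productOf]
    exact torsion_congr (eq_leftInvariantConnection (covField_of_isLeftInvariant h))
  have hb : IsBiInvariant nabla ↔ IsBiInvariant (connectionOf (productOf nabla)) :=
    ⟨IsBiInvariant.congr hs, IsBiInvariant.congr fun Y hY => (hs Y hY).symm⟩
  have hc : SameCurvature nabla nablaZero ↔
      SameCurvature (connectionOf (productOf nabla)) nablaZero := by
    refine forall₃_congr fun X Y Z => forall₃_congr fun hX hY hZ => ?_
    rw [curvatureField_congr hs hn hX hY hZ]
  rw [isPoissonProduct_iff, ht, hb, hc]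

theorem isSpecial_connectionOf
    {mul : GroupLieAlgebra I G →ₗ[𝕜] GroupLieAlgebra I G →ₗ[𝕜] GroupLieAlgebra I G}
    (h : IsPoissonProduct mul) : IsSpecial (connectionOf mul) := by
  obtain ⟨h1, h2, h3⟩ := isPoissonProduct_iff.1 h
  exact ⟨contMDiffCovariantDerivative_leftInvariantConnection _, h1, h2, h3⟩

theorem IsSpecial.isPoissonProduct
    {nabla : CovariantDerivative I E (TangentSpace I : G → Type _)} (h : IsSpecial nabla) :
    IsPoissonProduct (productOf nabla) :=
  (isPoissonProduct_productOf_iff h.smooth h.biInvariant.1).2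
    ⟨h.torsionFree, h.biInvariant, h.sameCurvature⟩

variable (I G) in
/-- Special connections correspond to Poisson structures on the Lie algebra. -/
noncomputable def specialConnectionsEquiv : SpecialConnections I G ≃ PoissonProducts I G where
  toFun := Quotient.lift
    (fun nabla : {nabla : CovariantDerivative I E (TangentSpace I : G → Type _) //
      IsSpecial nabla} => (⟨productOf nabla.1, nabla.2.isPoissonProduct⟩ : PoissonProducts I G))
    (fun _ _ h => Subtype.ext (productOf_congr h))
  invFun mul := SpecialConnections.mk (connectionOf mul.1) (isSpecial_connectionOf mul.2)
  left_inv := by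
    rintro ⟨nabla, h⟩
    refine Quotient.sound fun Y hY => ?_
    exact (sameConnection_connectionOf_productOf h.biInvariant.1 Y hY).symm
  right_inv mul := Subtype.ext (productOf_connectionOf mul.1)

end

end LieConnection

theorem mainTheorem1 {𝕜 : Type*} [RCLike 𝕜]
    {E : Type*} [NormedAddCommGroup E] [NormedSpace 𝕜 E] [FiniteDimensional 𝕜 E] [CompleteSpace E]
    {H : Type*} [TopologicalSpace H] (I : ModelWithCorners 𝕜 E H) [I.Boundaryless]
    (G : Type*) [TopologicalSpace G] [ChartedSpace H G] [Group G] [LieGroup I ∞ G]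
    [ConnectedSpace G] :
    (∀ nabla : CovariantDerivative I E (TangentSpace I : G → Type _),
      nabla.ContMDiffCovariantDerivative ∞ → IsLeftInvariant nabla →
        (IsPoissonProduct (productOf nabla) ↔
          nabla.torsion = 0 ∧ IsBiInvariant nabla ∧ SameCurvature nabla nablaZero)) ∧
    (∀ mul : GroupLieAlgebra I G →ₗ[𝕜] GroupLieAlgebra I G →ₗ[𝕜] GroupLieAlgebra I G,
      IsPoissonProduct mul →
        (∀ u v : GroupLieAlgebra I G,
          covField (connectionOf mul) (mulInvariantVectorField u) (mulInvariantVectorField v) =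
            (1 / 2 : 𝕜) • mlieBracket I (mulInvariantVectorField u) (mulInvariantVectorField v) +
              mulInvariantVectorField (mul u v)) ∧
        (∀ nabla : CovariantDerivative I E (TangentSpace I : G → Type _),
          (∀ u v : GroupLieAlgebra I G,
            covField nabla (mulInvariantVectorField u) (mulInvariantVectorField v) =
              (1 / 2 : 𝕜) • mlieBracket I (mulInvariantVectorField u) (mulInvariantVectorField v) +
                mulInvariantVectorField (mul u v)) →
          SameConnection nabla (connectionOf mul)) ∧
        IsSpecial (connectionOf mul)) ∧
    (∃ Φ : SpecialConnections I G ≃ PoissonProducts I G,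
      (∀ nabla (h : IsSpecial nabla), (Φ (SpecialConnections.mk nabla h)).1 = productOf nabla) ∧
      (∀ (mul : PoissonProducts I G) (h : IsSpecial (connectionOf mul.1)),
        Φ.symm mul = SpecialConnections.mk (connectionOf mul.1) h)) := by
  refine ⟨fun nabla hn h => isPoissonProduct_productOf_iff hn h, fun mul h => ⟨fun u v => ?_,
    fun nabla hn Y hY => funext fun g => eq_leftInvariantConnection (fun u v => ?_)
      (hY.mdifferentiableAt g), isSpecial_connectionOf h⟩,
    specialConnectionsEquiv I G, fun _ _ => rfl, fun _ _ => rfl⟩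
  · rw [half_smul_mlieBracket_add]
    exact leftInvariantConnection_apply _ u v
  · rw [hn, half_smul_mlieBracket_add]
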